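/- Let $\mathcal T\subset\mathbb R$ be an interval, $\Theta=(\alpha,\beta)$ a bounded open interval, $\lambda(\vartheta,\cdot)\ge 0$ ($\vartheta\in[\alpha,\beta]$) intensity functions on $\mathcal T$, and $g$ a real function on $\mathcal T$ such that $m(\vartheta)=\int_{\mathcal T}g(t)\lambda(\vartheta,t)\,dt$ is well defined and continuous on $[\alpha,\beta]$. Assume that for some integer $k\ge 1$ the conditions $\mathcal L$ hold: ($\mathcal L_1$) $m$ has $k+2$ continuous bounded derivatives on $\Theta$; ($\mathcal L_2$) $m$ is monotone on $\Theta$ and $\inf_{\vartheta\in\Theta}|m'(\vartheta)|>0$; ($\mathcal L_3$) $\sup_{\vartheta\in\Theta}\int_{\mathcal T}|g(t)|^p\lambda(\vartheta,t)\,dt<\infty$ for every real $p>0$. Fix the true value $\vartheta_0\in\Theta$ and let $X_1,X_2,\dots$ be independent Poisson processes on $\mathcal T$ with intensity function $\lambda(\vartheta_0,\cdot)$. Put $\bar m_n=\frac1n\sum_{j=1}^n\int_{\mathcal T}g\,dX_j$ and let $\check\vartheta_n\in[\alpha,\beta]$ be the method of moments estimator, $\check\vartheta_n=\arg\inf_{\vartheta\in\Theta}(m(\vartheta)-\bar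 m_n)^2$ (which takes the value $\alpha$ or $\beta$ when the infimum is approached only at that end point). Let $G=m^{-1}$, $\psi_l=G^{(l)}(m(\vartheta_0))/l!$, $a_r=\int_{\mathcal T}g(t)^r\lambda(\vartheta_0,t)\,dt$, and $b_2=\psi_2\sqrt{a_2}/\psi_1$. Let $F$ and $f$ be the distribution function and the density of $\mathcal N(0,1)$. Suppose that $\psi_1>0$, $a_2>0$, and that for some constant $b>0$ $$\inf_{a_2b|v|>1}\int_{\mathcal T}\sin^2\bigl(v\,g(t)\bigr)\lambda(\vartheta_0,t)\,dt>0 .$$ Then, as $n\to\infty$, uniformly for $y$ in compact subsets of $\mathbb R$, $$\mathbf P_{\vartheta_0}\Bigl(\frac{\sqrt n(\check\vartheta_n-\vartheta_0)}{\psi_1\sqrt{a_2}}<y\Bigr)=F(y)+\frac{a_3-\bigl(a_3+6a_2^{3/2}b_2\bigr)y^2}{6a_2^{3/2}}\,f(y)\,n^{-1/2}+o(n^{-1/2}).$$ -/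

import Mathlib

open MeasureTheory ProbabilityTheory Filter
open scoped Nat ENNReal Topology

namespace PoissonMME

/-- The random measure `N` on the line is a Poisson process with intensity measure `μ`:
the number of points `N ω A` in a Borel set `A` with `μ A < ∞` has the Poisson law of mean `μ A`,
and the numbers of points in pairwise disjoint Borel sets are independent.
The counting process is `X(t) = N (Iic t)`, and integration against `N` is `∫ g dX`. -/
structure IsPoissonProcess {Ω : Type*} [MeasurableSpace Ω] (P : Measure Ω)
    (N : Ω → Measure ℝ) (μ : Measure ℝ) : Prop where
  measurable : Measurable N
  law_count : ∀ A : Set ℝ, MeasurableSet A → μ A < ∞ →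
    P.map (fun ω => N ω A) =
      (poissonMeasure (μ A).toNNReal).map (fun k : ℕ => (k : ℝ≥0∞))
  indep_count : ∀ (k : ℕ) (A : Fin k → Set ℝ), (∀ i, MeasurableSet (A i)) →
    Pairwise (fun i j => Disjoint (A i) (A j)) →
    iIndepFun (fun (i : Fin k) (ω : Ω) => N ω (A i)) P

/-- The intensity measure `lam t dt` on `T`. -/
noncomputable def intensityMeasure (T : Set ℝ) (lam : ℝ → ℝ) : Measure ℝ :=
  (volume.restrict T).withDensity (fun t => ENNReal.ofReal (lam t))

/-- `m(θ) = ∫_T g(t) λ(θ, t) dt`. -/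
noncomputable def meanFun (T : Set ℝ) (g : ℝ → ℝ) (lam : ℝ → ℝ → ℝ) (θ : ℝ) : ℝ :=
  ∫ t in T, g t * lam θ t

/-- `m̄_n = (1 / n) ∑_{j ≤ n} ∫_T g(t) dX_j(t)`; the observations are `X 0, …, X (n - 1)`. -/
noncomputable def empMean {Ω : Type*} (T : Set ℝ) (g : ℝ → ℝ) (X : ℕ → Ω → Measure ℝ)
    (n : ℕ) (ω : Ω) : ℝ :=
  (1 / (n : ℝ)) * ∑ j ∈ Finset.range n, ∫ t in T, g t ∂(X j ω)

/-- `x` is the method of moments estimate for `Θ = (α, β)` when the empirical mean is `y`: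
`x ∈ [α, β]` and `(m(x) - y)² ≤ (m(θ) - y)²` for all `θ ∈ Θ`. The infimum over the open interval
may be approached at an end point, so the estimate may be `α` or `β`. -/
def IsMME (α β : ℝ) (m : ℝ → ℝ) (y x : ℝ) : Prop :=
  x ∈ Set.Icc α β ∧ ∀ θ ∈ Set.Ioo α β, (m x - y) ^ 2 ≤ (m θ - y) ^ 2

/-- The regularity conditions on `Θ = (α, β)`:
`m` has `k + 2` continuous bounded derivatives on `Θ`; `m` is monotone on `Θ` with
`inf |m'| > 0`; and `sup_θ ∫_T |g|^p λ(θ, t) dt < ∞` for every real `p > 0`. -/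
structure Regularity (α β : ℝ) (T : Set ℝ) (g : ℝ → ℝ) (lam : ℝ → ℝ → ℝ) (k : ℕ) : Prop where
  smooth : ContDiffOn ℝ ((k + 2 : ℕ) : WithTop ℕ∞) (meanFun T g lam) (Set.Ioo α β)
  bounded : ∀ j : ℕ, 1 ≤ j → j ≤ k + 2 →
    ∃ C : ℝ, ∀ θ ∈ Set.Ioo α β, |iteratedDeriv j (meanFun T g lam) θ| ≤ C
  monotone : MonotoneOn (meanFun T g lam) (Set.Ioo α β) ∨
    AntitoneOn (meanFun T g lam) (Set.Ioo α β)
  deriv_lower : ∃ κ : ℝ, 0 < κ ∧ ∀ θ ∈ Set.Ioo α β, κ ≤ |deriv (meanFun T g lam) θ|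
  moments : ∀ p : ℝ, 0 < p →
    (⨆ θ ∈ Set.Ioo α β, ∫⁻ t in T, ENNReal.ofReal (|g t| ^ p * lam θ t)) < ∞

/-- The inverse `G = m⁻¹` of `m` restricted to `[α, β]`; only its values near `m(θ₀)` matter. -/
noncomputable def invMean (α β : ℝ) (T : Set ℝ) (g : ℝ → ℝ) (lam : ℝ → ℝ → ℝ) : ℝ → ℝ :=
  Function.invFunOn (meanFun T g lam) (Set.Icc α β)

/-- `ψ_l = G^{(l)}(m(θ₀)) / l!`. -/
noncomputable def psi (α β : ℝ) (T : Set ℝ) (g : ℝ → ℝ) (lam : ℝ → ℝ → ℝ) (θ₀ : ℝ)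
    (l : ℕ) : ℝ :=
  iteratedDeriv l (invMean α β T g lam) (meanFun T g lam θ₀) / (l ! : ℝ)

/-- `a_r = ∫_T g(t)^r λ(θ₀, t) dt`. -/
noncomputable def aCoef (T : Set ℝ) (g : ℝ → ℝ) (lam : ℝ → ℝ → ℝ) (θ₀ : ℝ) (r : ℕ) : ℝ :=
  ∫ t in T, g t ^ r * lam θ₀ t

/-- `b₂ = ψ₂ √a₂ / ψ₁`. -/
noncomputable def b2Coef (α β : ℝ) (T : Set ℝ) (g : ℝ → ℝ) (lam : ℝ → ℝ → ℝ) (θ₀ : ℝ) : ℝ :=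
  psi α β T g lam θ₀ 2 * √(aCoef T g lam θ₀ 2) / psi α β T g lam θ₀ 1

/-- The two-term expansion
`F(y) + (a₃ - (a₃ + 6 a₂^{3/2} b₂) y²) / (6 a₂^{3/2}) · f(y) · n^{-1/2}`, where `F` and `f` are the
distribution function and the density of the standard normal law. -/
noncomputable def edgeworth (a₂ a₃ b₂ : ℝ) (n : ℕ) (y : ℝ) : ℝ :=
  cdf (gaussianReal 0 1) y +
    (a₃ - (a₃ + 6 * a₂ ^ (3 / 2 : ℝ) * b₂) * y ^ 2) / (6 * a₂ ^ (3 / 2 : ℝ)) *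
      gaussianPDFReal 0 1 y * (1 / √(n : ℝ))

end PoissonMME

open PoissonMME

/-! Put `d = ψ₁ √a₂` and `z = θ₀ + y d / √n`, which lies in `Θ` for large `n`. Since `ψ₁ > 0`, `m`
is strictly increasing, and the minimiser lies below `z` exactly when `m̄_n < m(z)`
(`IsMME.lt_iff`). So the distribution function of the normalized estimator at `y` equals that of the
standardized empirical mean `W` at the deterministic point `x = √n (m(z) - m(θ₀)) / √a₂`. Taylor's
formula gives `x = y - b₂ y² / √n + o(n^{-1/2})`, uniformly for `y` in a compact set. It remains to
expand the law of `W`.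

That expansion has error `O(1/n)` (`exists_abs_measureReal_Iio_sub_edgeCDF_le`). By Campbell's
formula (`IsPoissonProcess.charFun_integral`) the characteristic function of `W` is exactly `exp (n
κ(u / √(n a₂)))` with `κ(t) = ∫ (e^{itg} - 1 - itg) dμ`. For `|u| ≤ ε √n` a Taylor expansion of `κ`
compares it with `e^{-u²/2} (1 + c (iu)³ / √n)`, `c = a₃ / (6 a₂^{3/2})`. For larger `|u|` its
modulus is `exp (-2n ∫ sin² dμ)`, exponentially small by the Cramér condition.

The smoothing inequality `abs_measureReal_Iio_sub_edgeCDF_le` turns closeness of transforms into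
closeness of distribution functions. A Gaussian perturbation of variance `n⁻⁴` makes the inversion
integrals converge, and undoing it costs `O(1/n)`. Finally, replacing `y` by `x` shifts `F` by `-b₂
y² f(y) / √n`, which supplies the `b₂` term (`abs_edgeCDF_sub_edgeworth_le`). -/

namespace PoissonMME

/-! ### Integrals against a Poisson process and Campbell's formula. -/

lemma lintegral_natCast_poissonMeasure (r : NNReal) :
    ∫⁻ k : ℕ, (k : ℝ≥0∞) ∂(poissonMeasure r) = r := by
  have hp : ∀ n : ℕ, ENNReal.ofReal (Real.exp (-r) * r ^ (n + 1) / (n + 1)!) * ((n + 1 : ℕ) : ℝ≥0∞) =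
      r * ENNReal.ofReal (Real.exp (-r) * r ^ n / n !) := by
    intro n
    rw [← ENNReal.ofReal_natCast, ← ENNReal.ofReal_coe_nnreal, ← ENNReal.ofReal_mul (by positivity),
      ← ENNReal.ofReal_mul (by positivity)]
    congr 1
    rw [Nat.factorial_succ]
    push_cast
    field_simp
    ring
  have h1 : ∑' n : ℕ, ENNReal.ofReal (Real.exp (-r) * r ^ n / n !) = 1 := by
    rw [← ENNReal.ofReal_tsum_of_nonneg (fun n => by positivity) (hasSum_one_poissonMeasure r).summable,
      (hasSum_one_poissonMeasure r).tsum_eq, ENNReal.ofReal_one]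
  rw [poissonMeasure, lintegral_sum_measure]
  simp only [lintegral_smul_measure, lintegral_dirac, smul_eq_mul]
  rw [tsum_eq_zero_add' ENNReal.summable]
  simp only [hp, ENNReal.tsum_mul_left, h1]
  simp

/-- Integration of a fixed measurable function is a measurable function of the measure. -/
lemma measurable_integral_measure {g : ℝ → ℝ} (hg : Measurable g) :
    Measurable (fun M : Measure ℝ => ∫ t, g t ∂M) := by
  have h1 : MeasurableSet {M : Measure ℝ | ∫⁻ t, ‖g t‖ₑ ∂M < ∞} :=
    measurableSet_lt (Measure.measurable_lintegral hg.enorm) measurable_const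
  -- The Bochner integral is `0` off the set of measures that integrate `g`, hence the indicator.
  have h2 : (fun M : Measure ℝ => ∫ t, g t ∂M) =
      {M : Measure ℝ | ∫⁻ t, ‖g t‖ₑ ∂M < ∞}.indicator (fun M =>
        (∫⁻ t, ENNReal.ofReal (g t) ∂M).toReal - (∫⁻ t, ENNReal.ofReal (-g t) ∂M).toReal) := by
    ext M
    by_cases h : ∫⁻ t, ‖g t‖ₑ ∂M < ∞
    · rw [Set.indicator_of_mem (by exact h)]
      exact integral_eq_lintegral_pos_part_sub_lintegral_neg_part
        ⟨hg.aestronglyMeasurable, h⟩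
    · rw [Set.indicator_of_notMem (by exact h)]
      exact integral_undef fun hi => h hi.2
  rw [h2]
  exact Measurable.indicator ((Measure.measurable_lintegral hg.ennreal_ofReal).ennreal_toReal.sub
    (Measure.measurable_lintegral hg.neg.ennreal_ofReal).ennreal_toReal) h1

section Campbell

variable {Ω : Type*} [MeasurableSpace Ω] {P : Measure Ω}
  {N : Ω → Measure ℝ} {μ : Measure ℝ}

lemma IsPoissonProcess.measurable_apply (hN : IsPoissonProcess P N μ) {A : Set ℝ}
    (hA : MeasurableSet A) : Measurable (fun ω => N ω A) :=
  (Measure.measurable_coe hA).comp hN.measurable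

/-- The mean measure of a Poisson process is its intensity measure. -/
lemma IsPoissonProcess.bind_eq [SigmaFinite μ] (hN : IsPoissonProcess P N μ) :
    P.bind N = μ := by
  have hfin : ∀ A, MeasurableSet A → μ A < ∞ → P.bind N A = μ A := by
    intro A hA hlt
    rw [Measure.bind_apply hA hN.measurable.aemeasurable]
    have : ∫⁻ ω, N ω A ∂P = ∫⁻ x, x ∂(P.map (fun ω => N ω A)) :=
      (lintegral_map (f := fun x => x) measurable_id (hN.measurable_apply hA)).symm
    rw [this, hN.law_count A hA hlt, lintegral_map (f := fun x => x) measurable_id (by fun_prop),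
      lintegral_natCast_poissonMeasure, ENNReal.coe_toNNReal hlt.ne]
  ext A hA
  -- The law of the counts is prescribed only on sets of finite intensity; the general case follows
  -- by exhaustion.
  have hmono : Monotone fun n => A ∩ spanningSets μ n := fun i j hij =>
    Set.inter_subset_inter_right _ (monotone_spanningSets μ hij)
  have hU : A = ⋃ n, A ∩ spanningSets μ n := by
    rw [← Set.inter_iUnion, iUnion_spanningSets, Set.inter_univ]
  rw [hU, hmono.measure_iUnion, hmono.measure_iUnion]
  refine iSup_congr fun n => hfin _ (hA.inter (measurableSet_spanningSets μ n)) ?_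
  exact (measure_mono Set.inter_subset_right).trans_lt (measure_spanningSets_lt_top μ n)

lemma IsPoissonProcess.lintegral_lintegral [SigmaFinite μ] (hN : IsPoissonProcess P N μ)
    {f : ℝ → ℝ≥0∞} (hf : Measurable f) : ∫⁻ ω, ∫⁻ t, f t ∂(N ω) ∂P = ∫⁻ t, f t ∂μ := by
  conv_rhs => rw [← hN.bind_eq]
  rw [Measure.lintegral_bind hN.measurable.aemeasurable hf.aemeasurable]

/-- The mean of `∫ |g| dN` is finite. Pathwise linearity of the integral is available only on this
almost sure event. -/
lemma IsPoissonProcess.ae_integrable [SigmaFinite μ] (hN : IsPoissonProcess P N μ)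
    {g : ℝ → ℝ} (hg : Measurable g) (hi : Integrable g μ) : ∀ᵐ ω ∂P, Integrable g (N ω) := by
  have h : ∫⁻ ω, ∫⁻ t, ‖g t‖ₑ ∂(N ω) ∂P ≠ ∞ := by
    rw [hN.lintegral_lintegral hg.enorm]; exact hi.2.ne
  filter_upwards [ae_lt_top ((Measure.measurable_lintegral hg.enorm).comp hN.measurable) h]
    with ω hω using ⟨hg.aestronglyMeasurable, hω⟩

lemma IsPoissonProcess.charFun_count (hN : IsPoissonProcess P N μ) {A : Set ℝ}
    (hA : MeasurableSet A) (hlt : μ A < ∞) (u : ℝ) :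
    charFun (P.map fun ω => (N ω A).toReal) u =
      Complex.exp (μ.real A * (Complex.exp (u * Complex.I) - 1)) := by
  have h : P.map (fun ω => (N ω A).toReal) =
      (poissonMeasure (μ A).toNNReal).map (fun k : ℕ => (k : ℝ)) := by
    have : (fun ω => (N ω A).toReal) = ENNReal.toReal ∘ fun ω => N ω A := rfl
    rw [this, ← Measure.map_map ENNReal.measurable_toReal (hN.measurable_apply hA),
      hN.law_count A hA hlt, Measure.map_map ENNReal.measurable_toReal (by fun_prop)]
    congr 1
  rw [h, charFun_map_cast_poissonMeasure]
  rfl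

lemma IsPoissonProcess.charFun_sum_count (hN : IsPoissonProcess P N μ) {k : ℕ}
    (A : Fin k → Set ℝ) (hA : ∀ i, MeasurableSet (A i)) (hlt : ∀ i, μ (A i) < ∞)
    (hd : Pairwise fun i j => Disjoint (A i) (A j)) (c : Fin k → ℝ) (u : ℝ) :
    charFun (P.map fun ω => ∑ i, c i * (N ω (A i)).toReal) u =
      Complex.exp (∑ i, μ.real (A i) * (Complex.exp (u * c i * Complex.I) - 1)) := by
  have hm : ∀ i, Measurable fun ω => (N ω (A i)).toReal := fun i =>
    (hN.measurable_apply (hA i)).ennreal_toReal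
  have hind : iIndepFun (fun (i : Fin k) ω => c i * (N ω (A i)).toReal) P :=
    (hN.indep_count k A hA hd).comp (fun i x => c i * x.toReal)
      (fun i => ENNReal.measurable_toReal.const_mul _)
  rw [hind.charFun_map_fun_sum_eq_prod (fun i => ((hm i).const_mul _).aemeasurable),
    Finset.prod_apply, Complex.exp_sum]
  refine Finset.prod_congr rfl fun i _ => ?_
  rw [charFun_map_mul_comp (hm i).aemeasurable, hN.charFun_count (hA i) (hlt i)]
  push_cast
  ring_nf

lemma norm_exp_mul_I_sub_le (x y : ℝ) :
    ‖Complex.exp (x * Complex.I) - Complex.exp (y * Complex.I)‖ ≤ ‖x - y‖ := by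
  have h : Complex.exp (x * Complex.I) - Complex.exp (y * Complex.I) =
      Complex.exp (y * Complex.I) * (Complex.exp (Complex.I * ((x - y : ℝ) : ℂ)) - 1) := by
    rw [mul_sub, ← Complex.exp_add]
    push_cast
    ring_nf
  rw [h, norm_mul, Complex.norm_exp_ofReal_mul_I, one_mul]
  exact Real.norm_exp_I_mul_ofReal_sub_one_le

lemma enorm_exp_mul_I_sub_le (u x y : ℝ) :
    ‖Complex.exp (u * x * Complex.I) - Complex.exp (u * y * Complex.I)‖ₑ ≤ ‖u‖ₑ * ‖x - y‖ₑ := by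
  have h := norm_exp_mul_I_sub_le (u * x) (u * y)
  push_cast at h
  rw [← enorm_mul, mul_sub]
  exact enorm_le_iff_norm_le.2 h

lemma IsPoissonProcess.charFun_simpleFunc [SigmaFinite μ] (hN : IsPoissonProcess P N μ)
    (s : SimpleFunc ℝ ℝ) (hs : Integrable s μ) (u : ℝ) :
    charFun (P.map fun ω => ∫ t, s t ∂(N ω)) u =
      Complex.exp (∫ t, (Complex.exp (u * s t * Complex.I) - 1) ∂μ) := by
  classical
  -- The fibre over `0` may have infinite intensity, so its count is not controlled; it contributes
  -- nothing to either side and is removed.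
  set F : Finset ℝ := s.range.filter (· ≠ 0) with hF
  let e : Fin F.card ≃ F := F.equivFin.symm
  have hne : ∀ i, ((e i : F) : ℝ) ≠ 0 := fun i => (Finset.mem_filter.1 (e i).2).2
  have hsum : ∀ {E : Type} [AddCommMonoid E] (w : ℝ → E), w 0 = 0 →
      ∑ x ∈ s.range, w x = ∑ i, w (e i) := by
    intro E _ w hw
    rw [e.sum_comp (fun x : F => w x), Finset.sum_coe_sort F w, hF, Finset.sum_filter_of_ne]
    intro x _ hx h0
    exact hx (h0 ▸ hw)
  have hR : ∫ t, (Complex.exp (u * s t * Complex.I) - 1) ∂μ =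
      ∑ i, μ.real (s ⁻¹' {((e i : F) : ℝ)}) * (Complex.exp (u * (e i : ℝ) * Complex.I) - 1) := by
    have h1 := SimpleFunc.map_integral (μ := μ) s
      (fun x : ℝ => Complex.exp (u * x * Complex.I) - 1) hs (by simp)
    have h2 : Integrable (s.map fun x : ℝ => Complex.exp (u * x * Complex.I) - 1) μ :=
      SimpleFunc.integrable_iff_finMeasSupp.2
        ((SimpleFunc.integrable_iff_finMeasSupp.1 hs).map (by simp))
    rw [← hsum (fun x : ℝ => (μ.real (s ⁻¹' {x}) : ℂ) * (Complex.exp (u * x * Complex.I) - 1))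
      (by simp)]
    rw [SimpleFunc.integral_eq_integral _ h2] at h1
    simpa using h1
  have hL : (fun ω => ∫ t, s t ∂(N ω)) =ᵐ[P]
      fun ω => ∑ i, ((e i : F) : ℝ) * (N ω (s ⁻¹' {((e i : F) : ℝ)})).toReal := by
    filter_upwards [hN.ae_integrable s.measurable hs] with ω hω
    rw [← SimpleFunc.integral_eq_integral _ hω, SimpleFunc.integral_eq,
      ← hsum (fun x : ℝ => x * (N ω (s ⁻¹' {x})).toReal) (by simp)]
    simp [Measure.real, mul_comm]
  rw [Measure.map_congr hL, hR]
  refine hN.charFun_sum_count _ (fun i => s.measurableSet_fiber _)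
    (fun i => ?_) (fun i j hij => ?_) _ u
  · exact (SimpleFunc.integrable_iff.1 hs) _ (hne i)
  · refine Disjoint.preimage _ (Set.disjoint_singleton.2 fun h => hij ?_)
    exact e.injective (Subtype.ext h)

/-- Campbell's formula for the characteristic function of the integral of `g` with respect to a
Poisson process. -/
theorem IsPoissonProcess.charFun_integral [IsProbabilityMeasure P] [SigmaFinite μ]
    (hN : IsPoissonProcess P N μ) {g : ℝ → ℝ} (hg : Measurable g) (hi : Integrable g μ) (u : ℝ) :
    charFun (P.map fun ω => ∫ t, g t ∂(N ω)) u =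
      Complex.exp (∫ t, (Complex.exp (u * g t * Complex.I) - 1) ∂μ) := by
  let s : ℕ → SimpleFunc ℝ ℝ := fun n =>
    SimpleFunc.approxOn g hg (Set.range g ∪ {0}) 0 (by simp) n
  have hs : ∀ n, Integrable (s n) μ := SimpleFunc.integrable_approxOn_range hg hi
  -- This single `L¹` distance dominates the error on both sides of the formula, because `x ↦
  -- e^{iux}` is `|u|`-Lipschitz.
  have hlim : Tendsto (fun n => ‖u‖ₑ * ∫⁻ t, ‖s n t - g t‖ₑ ∂μ) atTop (𝓝 0) := by
    have := SimpleFunc.tendsto_approxOn_range_L1_enorm hg hi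
    simpa only [mul_zero] using ENNReal.Tendsto.const_mul this (Or.inr (enorm_ne_top (x := u)))
  have hint : ∀ {f : ℝ → ℝ}, Measurable f → Integrable f μ →
      Integrable (fun t => Complex.exp (u * f t * Complex.I) - 1) μ := by
    intro f hf hfi
    refine (hfi.norm.const_mul |u|).mono' (by fun_prop) (ae_of_all _ fun t => ?_)
    have := norm_exp_mul_I_sub_le (u * f t) 0
    simpa using this
  have hmS : ∀ {f : ℝ → ℝ}, Measurable f → Measurable fun ω => ∫ t, f t ∂(N ω) :=
    fun hf => (measurable_integral_measure hf).comp hN.measurable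
  have hcharS : ∀ {f : ℝ → ℝ}, Measurable f → charFun (P.map fun ω => ∫ t, f t ∂(N ω)) u =
      ∫ ω, Complex.exp (u * (∫ t, f t ∂(N ω) : ℝ) * Complex.I) ∂P := by
    intro f hf
    rw [charFun_apply_real, integral_map (hmS hf).aemeasurable (by fun_prop)]
  have hintS : ∀ {f : ℝ → ℝ}, Measurable f →
      Integrable (fun ω => Complex.exp (u * (∫ t, f t ∂(N ω) : ℝ) * Complex.I)) P := by
    intro f hf
    have hm : Measurable fun x : ℝ => Complex.exp (u * x * Complex.I) := by fun_prop
    refine (integrable_const (1 : ℝ)).mono' (hm.comp (hmS hf)).aestronglyMeasurable (ae_of_all _ fun ω => ?_)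
    have h := Complex.norm_exp_ofReal_mul_I (u * ∫ t, f t ∂(N ω))
    push_cast at h
    exact h.le
  have h1 : Tendsto (fun n => charFun (P.map fun ω => ∫ t, s n t ∂(N ω)) u) atTop
      (𝓝 (charFun (P.map fun ω => ∫ t, g t ∂(N ω)) u)) := by
    simp only [hcharS (s _).measurable, hcharS hg]
    refine tendsto_integral_of_L1 _ (hintS hg).aestronglyMeasurable
      (Eventually.of_forall fun n => hintS (s n).measurable) ?_
    refine tendsto_of_tendsto_of_tendsto_of_le_of_le tendsto_const_nhds hlim
      (fun _ => zero_le) fun n => ?_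
    have hmd : Measurable fun t => ‖s n t - g t‖ₑ := ((s n).measurable.sub hg).enorm
    simp only
    -- The mean-measure formula replaces the deterministic `L¹` distance by the expected random one.
    rw [← hN.lintegral_lintegral hmd, ← lintegral_const_mul' _ _ enorm_ne_top]
    refine lintegral_mono_ae ?_
    filter_upwards [hN.ae_integrable hg hi, hN.ae_integrable (s n).measurable (hs n)]
      with ω h1 h2
    refine (enorm_exp_mul_I_sub_le _ _ _).trans ?_
    rw [← integral_sub h2 h1]
    gcongr
    exact enorm_integral_le_lintegral_enorm _
  have h2 : Tendsto (fun n => Complex.exp (∫ t, (Complex.exp (u * s n t * Complex.I) - 1) ∂μ)) atTop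
      (𝓝 (Complex.exp (∫ t, (Complex.exp (u * g t * Complex.I) - 1) ∂μ))) := by
    refine (Complex.continuous_exp.tendsto _).comp ?_
    refine tendsto_integral_of_L1 _ (hint hg hi).aestronglyMeasurable
      (Eventually.of_forall fun n => hint (s n).measurable (hs n)) ?_
    refine tendsto_of_tendsto_of_tendsto_of_le_of_le tendsto_const_nhds hlim
      (fun _ => zero_le) fun n => ?_
    simp only
    rw [← lintegral_const_mul' _ _ enorm_ne_top]
    refine lintegral_mono fun t => ?_
    simp only [sub_sub_sub_cancel_right]
    exact enorm_exp_mul_I_sub_le _ _ _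
  simp only [fun n => hN.charFun_simpleFunc (s n) (hs n) u] at h1
  exact tendsto_nhds_unique h1 h2

end Campbell

/-! ### The Gaussian density and the Edgeworth approximation. -/

/-- The one-term Edgeworth approximation `F(x) - c (x² - 1) f(x)` of a distribution function. -/
noncomputable def edgeCDF (c x : ℝ) : ℝ :=
  cdf (gaussianReal 0 1) x - c * (x ^ 2 - 1) * gaussianPDFReal 0 1 x

/-- The derivative of `edgeCDF c`. -/
noncomputable def edgePDF (c x : ℝ) : ℝ :=
  gaussianPDFReal 0 1 x * (1 + c * (x ^ 3 - 3 * x))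

/-- The Fourier transform of `edgePDF c`. -/
noncomputable def edgeCharFun (c u : ℝ) : ℂ :=
  Complex.exp (-(u ^ 2 / 2 : ℝ)) * (1 + c * (u * Complex.I) ^ 3)

lemma gaussianPDFReal_std (x : ℝ) :
    gaussianPDFReal 0 1 x = (√(2 * Real.pi))⁻¹ * Real.exp (-(x ^ 2 / 2)) := by
  simp [gaussianPDFReal, neg_div]

lemma continuous_gaussianPDFReal_std : Continuous (gaussianPDFReal 0 1) := by
  have : gaussianPDFReal 0 1 = fun x => (√(2 * Real.pi))⁻¹ * Real.exp (-(x ^ 2 / 2)) :=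
    funext gaussianPDFReal_std
  rw [this]
  fun_prop

lemma hasDerivAt_gaussianPDFReal_std (x : ℝ) :
    HasDerivAt (gaussianPDFReal 0 1) (-x * gaussianPDFReal 0 1 x) x := by
  have : gaussianPDFReal 0 1 = fun x => (√(2 * Real.pi))⁻¹ * Real.exp (-(x ^ 2 / 2)) :=
    funext gaussianPDFReal_std
  rw [this]
  have h : HasDerivAt (fun x : ℝ => -(x ^ 2 / 2)) (-x) x := by
    refine (((hasDerivAt_pow 2 x).div_const 2).neg).congr_deriv ?_
    simp
  refine (h.exp.const_mul (√(2 * Real.pi))⁻¹).congr_deriv ?_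
  ring

lemma cdf_gaussianReal_std (x : ℝ) :
    cdf (gaussianReal 0 1) x = ∫ t in Set.Iic x, gaussianPDFReal 0 1 t := by
  rw [cdf_eq_real, measureReal_def, gaussianReal_apply_eq_integral 0 one_ne_zero,
    ENNReal.toReal_ofReal (integral_nonneg fun t => gaussianPDFReal_nonneg 0 1 t)]

lemma hasDerivAt_cdf_gaussianReal_std (x : ℝ) :
    HasDerivAt (cdf (gaussianReal 0 1)) (gaussianPDFReal 0 1 x) x := by
  have hi := integrable_gaussianPDFReal 0 1
  have h : (cdf (gaussianReal 0 1) : ℝ → ℝ) =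
      fun x => (∫ t in (0:ℝ)..x, gaussianPDFReal 0 1 t) + cdf (gaussianReal 0 1) 0 := by
    ext y
    rw [cdf_gaussianReal_std, cdf_gaussianReal_std,
      ← intervalIntegral.integral_Iic_sub_Iic hi.integrableOn hi.integrableOn]
    ring
  rw [h]
  exact (intervalIntegral.integral_hasDerivAt_right hi.intervalIntegrable
    (continuous_gaussianPDFReal_std.stronglyMeasurableAtFilter _ _)
    continuous_gaussianPDFReal_std.continuousAt).add_const _

lemma hasDerivAt_edgeCDF (c x : ℝ) : HasDerivAt (edgeCDF c) (edgePDF c x) x := by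
  have h1 : HasDerivAt (fun x : ℝ => c * (x ^ 2 - 1)) (c * (2 * x)) x := by
    simpa using ((hasDerivAt_pow 2 x).sub_const 1).const_mul c
  have := (hasDerivAt_cdf_gaussianReal_std x).sub (h1.mul (hasDerivAt_gaussianPDFReal_std x))
  refine this.congr_deriv ?_
  simp only [edgePDF]
  ring

lemma continuous_edgePDF (c : ℝ) : Continuous (edgePDF c) := by
  have := continuous_gaussianPDFReal_std
  unfold edgePDF
  fun_prop

/-- From `e^t ≥ 1 + t + t²/2` at `t = x²/2`. The quartic polynomial dominates every polynomial
factor that multiplies the density below. -/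
lemma gaussianPDFReal_std_le (x : ℝ) : gaussianPDFReal 0 1 x * (1 + x ^ 2 / 2 + x ^ 4 / 8) ≤ 1 := by
  have h1 : 1 + x ^ 2 / 2 + x ^ 4 / 8 ≤ Real.exp (x ^ 2 / 2) := by
    have := Real.quadratic_le_exp_of_nonneg (by positivity : 0 ≤ x ^ 2 / 2)
    nlinarith
  have h2 : (√(2 * Real.pi))⁻¹ ≤ 1 := by
    refine inv_le_one_of_one_le₀ (Real.one_le_sqrt.2 ?_)
    linarith [Real.pi_gt_three]
  rw [gaussianPDFReal_std]
  calc _ ≤ 1 * Real.exp (-(x ^ 2 / 2)) * Real.exp (x ^ 2 / 2) := by gcongr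
    _ = 1 := by rw [one_mul, ← Real.exp_add]; simp

lemma abs_gaussianPDFReal_mul_cubic_le (x : ℝ) :
    |gaussianPDFReal 0 1 x * (x ^ 3 - 3 * x)| ≤ 10 := by
  have h := gaussianPDFReal_std_le x
  have h0 := gaussianPDFReal_nonneg 0 1 x
  have h2 : |x ^ 3 - 3 * x| ≤ 10 * (1 + x ^ 2 / 2 + x ^ 4 / 8) := by
    rw [abs_le]
    constructor <;> nlinarith [sq_nonneg (x ^ 2 - x), sq_nonneg (x ^ 2 + x), sq_nonneg (x - 1),
      sq_nonneg (x + 1), sq_nonneg (x^2)]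
  rw [abs_mul, abs_of_nonneg h0]
  calc _ ≤ gaussianPDFReal 0 1 x * (10 * (1 + x ^ 2 / 2 + x ^ 4 / 8)) := by gcongr
    _ ≤ 10 := by linarith

lemma gaussianPDFReal_std_le_one (x : ℝ) : gaussianPDFReal 0 1 x ≤ 1 := by
  refine le_trans (le_mul_of_one_le_right (gaussianPDFReal_nonneg 0 1 x) ?_)
    (gaussianPDFReal_std_le x)
  have : 0 ≤ x ^ 2 / 2 + x ^ 4 / 8 := by positivity
  linarith

lemma abs_edgePDF_le {c : ℝ} (hc : |c| ≤ 1) (x : ℝ) : |edgePDF c x| ≤ 11 := by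
  have h : edgePDF c x = gaussianPDFReal 0 1 x + c * (gaussianPDFReal 0 1 x * (x ^ 3 - 3 * x)) := by
    rw [edgePDF]; ring
  rw [h]
  refine (abs_add_le _ _).trans ?_
  rw [abs_of_nonneg (gaussianPDFReal_nonneg 0 1 x), abs_mul]
  have := mul_le_mul hc (abs_gaussianPDFReal_mul_cubic_le x) (abs_nonneg _) zero_le_one
  linarith [gaussianPDFReal_std_le_one x]

lemma tendsto_edgeCDF_atBot (c : ℝ) : Tendsto (edgeCDF c) atBot (𝓝 0) := by
  have h2 : Tendsto (fun x : ℝ => 1 / (x ^ 2)) atBot (𝓝 0) := by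
    refine ((tendsto_pow_atTop (α := ℝ) two_ne_zero).inv_tendsto_atTop.comp
      tendsto_neg_atBot_atTop).congr fun x => ?_
    simp
  have h1 : Tendsto (fun x => c * (x ^ 2 - 1) * gaussianPDFReal 0 1 x) atBot (𝓝 0) := by
    refine squeeze_zero_norm' (a := fun x : ℝ => 8 * |c| * (1 / x ^ 2)) ?_ (by simpa using h2.const_mul (8 * |c|))
    filter_upwards [eventually_lt_atBot (0:ℝ)] with x hx
    have h0 := gaussianPDFReal_nonneg 0 1 x
    have hx2 : 0 < x ^ 2 := sq_pos_of_neg hx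
    rw [Real.norm_eq_abs, abs_mul, abs_mul, abs_of_nonneg h0, mul_comm 8, mul_assoc, mul_assoc]
    refine mul_le_mul_of_nonneg_left ?_ (abs_nonneg c)
    rw [mul_one_div, le_div_iff₀ hx2]
    have h3 : |x ^ 2 - 1| ≤ x ^ 2 + 1 := by rw [abs_le]; constructor <;> nlinarith
    calc |x ^ 2 - 1| * gaussianPDFReal 0 1 x * x ^ 2
        ≤ (x ^ 2 + 1) * gaussianPDFReal 0 1 x * x ^ 2 := by gcongr
      _ = gaussianPDFReal 0 1 x * (x ^ 2 + x ^ 4) := by ring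
      _ ≤ gaussianPDFReal 0 1 x * (8 * (1 + x ^ 2 / 2 + x ^ 4 / 8)) := by
          gcongr; nlinarith
      _ ≤ 8 := by linarith [gaussianPDFReal_std_le x]
  simpa [edgeCDF] using! (tendsto_cdf_atBot (gaussianReal 0 1)).sub h1

lemma integral_edgePDF (c a x : ℝ) : ∫ s in a..x, edgePDF c s = edgeCDF c x - edgeCDF c a :=
  intervalIntegral.integral_eq_sub_of_hasDerivAt (fun s _ => hasDerivAt_edgeCDF c s)
    ((continuous_edgePDF c).intervalIntegrable _ _)

/-! ### Fourier transforms of the Gaussian and Edgeworth densities. -/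

lemma charFun_std_eq : charFun (gaussianReal 0 1) = fun t : ℝ => Complex.exp (-(t ^ 2 / 2)) := by
  ext t
  rw [charFun_gaussianReal]
  simp

lemma hasDerivAt_exp_neg_sq (t : ℝ) :
    HasDerivAt (fun t : ℝ => Complex.exp (-(t ^ 2 / 2))) (-t * Complex.exp (-(t ^ 2 / 2))) t := by
  have h : HasDerivAt (fun x : ℝ => (-((x : ℂ) ^ 2 / 2))) (-(t : ℂ)) t := by
    have := (((hasDerivAt_pow 2 (t : ℂ)).div_const 2).neg).comp_ofReal
    refine this.congr_deriv ?_
    simp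
  refine h.cexp.congr_deriv ?_
  ring

lemma integral_cube_mul_exp_gaussianReal (t : ℝ) :
    ∫ x, ((x * Complex.I : ℂ)) ^ 3 * Complex.exp (t * x * Complex.I) ∂(gaussianReal 0 1) =
      (3 * t - t ^ 3) * Complex.exp (-(t ^ 2 / 2)) := by
  have h := iteratedDeriv_charFun (μ := gaussianReal 0 1) (n := 3) (t := t)
    (memLp_id_gaussianReal' _ (by simp))
  have h1 : deriv (fun t : ℝ => Complex.exp (-(t ^ 2 / 2))) =
      fun t : ℝ => -t * Complex.exp (-(t ^ 2 / 2)) := funext fun t => (hasDerivAt_exp_neg_sq t).deriv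
  have hid : ∀ t : ℝ, HasDerivAt (fun t : ℝ => (t : ℂ)) 1 t := fun t =>
    (hasDerivAt_id (t : ℂ)).comp_ofReal
  have h2 : deriv (fun t : ℝ => -t * Complex.exp (-(t ^ 2 / 2))) =
      fun t : ℝ => (t ^ 2 - 1) * Complex.exp (-(t ^ 2 / 2)) := funext fun t => by
    refine ((hid t).neg.mul (hasDerivAt_exp_neg_sq t)).deriv.trans ?_
    simp only [Pi.neg_apply]
    ring
  have h3 : deriv (fun t : ℝ => ((t : ℂ) ^ 2 - 1) * Complex.exp (-(t ^ 2 / 2))) =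
      fun t : ℝ => (3 * t - t ^ 3) * Complex.exp (-(t ^ 2 / 2)) := funext fun t => by
    refine ((((hid t).pow 2).sub_const 1).mul (hasDerivAt_exp_neg_sq t)).deriv.trans ?_
    simp
    ring
  rw [charFun_std_eq, iteratedDeriv_succ, iteratedDeriv_succ, iteratedDeriv_one, h1, h2, h3] at h
  beta_reduce at h
  rw [h, ← integral_const_mul]
  congr 1
  ext x
  ring

lemma integral_exp_gaussianReal (t : ℝ) :
    ∫ x : ℝ, Complex.exp (t * x * Complex.I) ∂(gaussianReal 0 1) = Complex.exp (-(t ^ 2 / 2)) := by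
  rw [← charFun_apply_real, charFun_std_eq]

lemma norm_cexp_neg_ofReal (x : ℝ) : ‖Complex.exp (-(x : ℂ))‖ = Real.exp (-x) := by
  rw [Complex.norm_exp]
  simp

lemma norm_cexp_neg_ofReal_mul_I (x : ℝ) : ‖Complex.exp (-(x : ℂ) * Complex.I)‖ = 1 := by
  rw [← Complex.ofReal_neg, Complex.norm_exp_ofReal_mul_I]

/-- Up to a constant, `e^{-vu²/2}` is the density of the normal law of variance `v⁻¹`, so its known
characteristic function at `-t` gives the integral. -/
lemma integral_exp_neg_mul_exp {v : NNReal} (hv : v ≠ 0) (t : ℝ) :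
    ∫ u : ℝ, Complex.exp (-(v * u ^ 2 / 2 : ℝ)) * Complex.exp (-(u * t : ℝ) * Complex.I) =
      2 * Real.pi * gaussianPDFReal 0 v t := by
  have hv' : (0 : ℝ) < v := NNReal.coe_pos.2 (pos_iff_ne_zero.2 hv)
  have h := charFun_gaussianReal (μ := 0) (v := v⁻¹) (-t)
  rw [charFun_apply_real, integral_gaussianReal_eq_integral_smul (inv_ne_zero hv)] at h
  have hp : ∀ u, gaussianPDFReal 0 v⁻¹ u • Complex.exp (((-t : ℝ) : ℂ) * u * Complex.I) =
      ((√(2 * Real.pi * (v : ℝ)⁻¹))⁻¹ : ℝ) *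
        (Complex.exp (-(v * u ^ 2 / 2 : ℝ)) * Complex.exp (-(u * t : ℝ) * Complex.I)) := by
    intro u
    have : -u ^ 2 / (2 * (v : ℝ)⁻¹) = -(v * u ^ 2 / 2) := by field_simp
    rw [gaussianPDFReal, Complex.real_smul, NNReal.coe_inv, sub_zero, this]
    push_cast
    ring_nf
  simp only [hp] at h
  rw [integral_const_mul] at h
  have h0 : (0 : ℝ) < √(2 * Real.pi * (v : ℝ)⁻¹) := Real.sqrt_pos.2 (by positivity)
  have h2 : √(2 * Real.pi * (v : ℝ)⁻¹) * √(2 * Real.pi * v) = 2 * Real.pi := by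
    rw [← Real.sqrt_mul (by positivity)]
    have : 2 * Real.pi * (v : ℝ)⁻¹ * (2 * Real.pi * v) = (2 * Real.pi) ^ 2 := by field_simp
    rw [this, Real.sqrt_sq (by positivity)]
  have h1 : (0 : ℝ) < √(2 * Real.pi * v) := Real.sqrt_pos.2 (by positivity)
  have h3 : ∫ u : ℝ, Complex.exp (-(v * u ^ 2 / 2 : ℝ)) * Complex.exp (-(u * t : ℝ) * Complex.I) =
      (√(2 * Real.pi * (v : ℝ)⁻¹) : ℝ) * Complex.exp (-(t ^ 2 / (2 * v) : ℝ)) := by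
    rw [Complex.ofReal_inv, inv_mul_eq_iff_eq_mul₀ (by exact_mod_cast h0.ne')] at h
    rw [h]
    congr 2
    push_cast
    field_simp
    ring
  rw [h3, gaussianPDFReal, sub_zero]
  have h4 : √(2 * Real.pi * (v : ℝ)⁻¹) = 2 * Real.pi * (√(2 * Real.pi * v))⁻¹ := by
    rw [eq_mul_inv_iff_mul_eq₀ h1.ne', h2]
  rw [h4]
  push_cast
  ring_nf

/-- Since `e^{-u²/2}` is `√(2π)` times the normal density, the inversion integral is a Gaussian
expectation; the cubic term is the third derivative of the Gaussian transform, which produces `s³ -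
3s`. -/
lemma integral_edgeCharFun_mul_exp (c s : ℝ) :
    ∫ u : ℝ, edgeCharFun c u * Complex.exp (-(u * s : ℝ) * Complex.I) =
      2 * Real.pi * edgePDF c s := by
  have hs : (0 : ℝ) < √(2 * Real.pi) := Real.sqrt_pos.2 (by positivity)
  have hsc : ((√(2 * Real.pi) : ℝ) : ℂ) ≠ 0 := by exact_mod_cast hs.ne'
  have h1 : ∫ u : ℝ, edgeCharFun c u * Complex.exp (-(u * s : ℝ) * Complex.I) =
      √(2 * Real.pi) * ∫ u : ℝ, (Complex.exp ((-s : ℝ) * u * Complex.I) +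
        c * ((u * Complex.I) ^ 3 * Complex.exp ((-s : ℝ) * u * Complex.I)))
          ∂(gaussianReal 0 1) := by
    rw [integral_gaussianReal_eq_integral_smul one_ne_zero, ← integral_const_mul]
    congr 1
    ext u
    rw [gaussianPDFReal_std, edgeCharFun, Complex.real_smul]
    push_cast
    field_simp
  have hb : ∀ u : ℝ, ‖Complex.exp ((-s : ℝ) * u * Complex.I)‖ = 1 := fun u => by
    have := Complex.norm_exp_ofReal_mul_I (-s * u)
    push_cast at this ⊢
    exact this
  have hi0 : Integrable (fun u : ℝ => Complex.exp ((-s : ℝ) * u * Complex.I)) (gaussianReal 0 1) :=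
    (integrable_const (1 : ℝ)).mono' (by fun_prop) (ae_of_all _ fun u => (hb u).le)
  have hi3 : Integrable (fun u : ℝ => (u * Complex.I) ^ 3 *
      Complex.exp ((-s : ℝ) * u * Complex.I)) (gaussianReal 0 1) := by
    have h3 := (memLp_id_gaussianReal' (μ := 0) (v := 1) 3 (by simp)).integrable_norm_pow (p := 3)
      (by simp)
    refine h3.mono' (by fun_prop) (ae_of_all _ fun u => ?_)
    simp only [norm_mul, hb, norm_pow]
    simp
  rw [h1, integral_add hi0 (hi3.const_mul _), integral_const_mul, integral_exp_gaussianReal,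
    integral_cube_mul_exp_gaussianReal, edgePDF, gaussianPDFReal_std]
  have h2 : (2 * Real.pi : ℂ) = √(2 * Real.pi) * √(2 * Real.pi) := by
    have := Real.mul_self_sqrt (by positivity : 0 ≤ 2 * Real.pi)
    exact_mod_cast this.symm
  rw [h2]
  push_cast
  field_simp
  ring_nf

/-! ### Fourier inversion over intervals and the smoothing inequality. -/

lemma norm_integral_exp_le (a x : ℝ) {u : ℝ} (hu : u ≠ 0) :
    ‖∫ s in a..x, Complex.exp (-(u * s : ℝ) * Complex.I)‖ ≤ 2 / |u| := by
  have hc : (-u * Complex.I : ℂ) ≠ 0 := by simpa using hu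
  have h := integral_exp_mul_complex (a := a) (b := x) hc
  have h1 : ∀ s : ℝ, Complex.exp (-(u * s : ℝ) * Complex.I) = Complex.exp (-u * Complex.I * s) := by
    intro s; congr 1; push_cast; ring
  have h2 : ∀ s : ℝ, ‖Complex.exp (-u * Complex.I * s)‖ = 1 := fun s => by
    have := Complex.norm_exp_ofReal_mul_I (-(u * s))
    rw [← h1]; simpa using this
  simp only [h1]
  rw [h, norm_div]
  have : ‖(-u * Complex.I : ℂ)‖ = |u| := by simp
  rw [this]
  gcongr
  refine (norm_sub_le _ _).trans ?_
  rw [h2, h2]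
  norm_num

/-- Fubini, with the oscillatory integral bounded by `2 / |u|`. The bound does not depend on `a`, so
`a → -∞` is possible later. -/
lemma norm_integral_integral_exp_le {D : ℝ → ℂ} (hD : Integrable D)
    (hD' : Integrable fun u => ‖D u‖ / |u|) (a x : ℝ) :
    ‖∫ s in a..x, ∫ u, D u * Complex.exp (-(u * s : ℝ) * Complex.I)‖ ≤ 2 * ∫ u, ‖D u‖ / |u| := by
  rw [intervalIntegral_integral_swap]
  · rw [← integral_const_mul]
    refine norm_integral_le_of_norm_le (hD'.const_mul 2) ?_
    have h0 : ∀ᵐ u : ℝ, u ≠ 0 := by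
      simp [ae_iff]
    filter_upwards [h0] with u hu
    rw [intervalIntegral.integral_const_mul, norm_mul]
    calc _ ≤ ‖D u‖ * (2 / |u|) := by gcongr; exact norm_integral_exp_le a x hu
      _ = _ := by ring
  · have : IsFiniteMeasure (volume.restrict (Set.uIoc a x)) :=
      ⟨by rw [Measure.restrict_apply_univ]; simp [Set.uIoc]⟩
    have h1 : Integrable (fun z : ℝ × ℝ => D z.2) ((volume.restrict (Set.uIoc a x)).prod volume) :=
      hD.comp_snd _
    have hm : AEStronglyMeasurable (fun z : ℝ × ℝ => Complex.exp (-(z.2 * z.1 : ℝ) * Complex.I))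
        ((volume.restrict (Set.uIoc a x)).prod volume) := by fun_prop
    refine h1.mul_bdd (c := 1) hm (ae_of_all _ fun z => ?_)
    exact (norm_cexp_neg_ofReal_mul_I (z.2 * z.1)).le

lemma gaussianReal_Ioc (w : ℝ) {v : NNReal} (hv : v ≠ 0) {a x : ℝ} (hax : a ≤ x) :
    (gaussianReal w v).real (Set.Ioc a x) = ∫ s in a..x, gaussianPDFReal 0 v (s - w) := by
  rw [measureReal_def, gaussianReal_apply_eq_integral w hv,
    ENNReal.toReal_ofReal (integral_nonneg fun t => gaussianPDFReal_nonneg _ _ _),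
    intervalIntegral.integral_of_le hax]
  simp only [gaussianPDFReal_sub, zero_add]

lemma continuous_edgeCharFun (c : ℝ) : Continuous (edgeCharFun c) := by
  unfold edgeCharFun
  fun_prop

lemma norm_edgeCharFun_le (c u : ℝ) :
    ‖edgeCharFun c u‖ ≤ Real.exp (-(u ^ 2 / 2)) * (1 + |c| * |u| ^ 3) := by
  rw [edgeCharFun, norm_mul, norm_cexp_neg_ofReal]
  gcongr
  refine (norm_add_le _ _).trans ?_
  simp

lemma integrable_abs_pow_mul_exp {b : ℝ} (hb : 0 < b) (k : ℕ) :
    Integrable fun u : ℝ => |u| ^ k * Real.exp (-(b * u ^ 2)) := by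
  have h := integrable_rpow_mul_exp_neg_mul_sq hb (s := k) (by linarith [k.cast_nonneg (α := ℝ)])
  refine h.norm.congr (ae_of_all _ fun u => ?_)
  simp

lemma integrable_edgeCharFun (c : ℝ) : Integrable (edgeCharFun c) := by
  have h0 := integrable_abs_pow_mul_exp (b := 1 / 2) (by norm_num) 0
  have h3 := integrable_abs_pow_mul_exp (b := 1 / 2) (by norm_num) 3
  refine (h0.add (h3.const_mul |c|)).mono' (continuous_edgeCharFun c).aestronglyMeasurable
    (ae_of_all _ fun u => (norm_edgeCharFun_le c u).trans (le_of_eq ?_))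
  simp only [Pi.add_apply]
  ring_nf

section Smoothing

variable {ν : Measure ℝ} [IsProbabilityMeasure ν] {v : NNReal}

lemma integrable_charFun_mul_exp (hv : v ≠ 0) :
    Integrable fun u : ℝ => charFun ν u * Complex.exp (-(v * u ^ 2 / 2 : ℝ)) := by
  have hv' : (0 : ℝ) < v := NNReal.coe_pos.2 (pos_iff_ne_zero.2 hv)
  have h0 := integrable_abs_pow_mul_exp (b := v / 2) (by positivity) 0
  have hm := (measurable_charFun (μ := ν)).aestronglyMeasurable (μ := volume)
  refine h0.mono' (by fun_prop) (ae_of_all _ fun u => ?_)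
  rw [norm_mul, norm_cexp_neg_ofReal, pow_zero]
  have : v * u ^ 2 / 2 = v / 2 * u ^ 2 := by ring
  rw [this]
  gcongr
  exact norm_charFun_le_one u

/-- Fourier inversion for the density of the convolution of `ν` with `N(0, v)`; the Gaussian factor
is what makes the integral absolutely convergent. -/
lemma integral_gaussianPDFReal_sub (hv : v ≠ 0) (s : ℝ) :
    (2 * Real.pi * (∫ w, gaussianPDFReal 0 v (s - w) ∂ν : ℝ) : ℂ) =
      ∫ u : ℝ, charFun ν u * Complex.exp (-(v * u ^ 2 / 2 : ℝ)) *
        Complex.exp (-(u * s : ℝ) * Complex.I) := by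
  have hv' : (0 : ℝ) < v := NNReal.coe_pos.2 (pos_iff_ne_zero.2 hv)
  rw [← integral_complex_ofReal, ← integral_const_mul]
  simp only [← integral_exp_neg_mul_exp hv]
  rw [integral_integral_swap]
  · congr 1
    ext u
    rw [charFun_apply_real, ← integral_mul_const, ← integral_mul_const]
    congr 1
    ext w
    rw [← Complex.exp_add, ← Complex.exp_add, ← Complex.exp_add]
    congr 1
    push_cast
    ring
  · have h0 := integrable_abs_pow_mul_exp (b := v / 2) (by positivity) 0
    have h1 : Integrable (fun z : ℝ × ℝ => |z.2| ^ 0 * Real.exp (-(v / 2 * z.2 ^ 2)))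
        (ν.prod volume) := h0.comp_snd _
    refine h1.mono' (by fun_prop) (ae_of_all _ fun z => le_of_eq ?_)
    simp only [Function.uncurry]
    rw [norm_mul, norm_cexp_neg_ofReal, norm_cexp_neg_ofReal_mul_I]
    ring_nf

lemma integrable_gaussianPDFReal_sub_prod (v : NNReal) (a x : ℝ) :
    Integrable (Function.uncurry fun s w : ℝ => gaussianPDFReal 0 v (s - w))
      ((volume.restrict (Set.uIoc a x)).prod ν) := by
  have : IsFiniteMeasure (volume.restrict (Set.uIoc a x)) :=
    ⟨by rw [Measure.restrict_apply_univ]; simp [Set.uIoc]⟩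
  have hpm : Continuous (Function.uncurry fun s w : ℝ => gaussianPDFReal 0 v (s - w)) := by
    unfold gaussianPDFReal Function.uncurry; fun_prop
  refine (integrable_const (√(2 * Real.pi * v))⁻¹).mono' hpm.aestronglyMeasurable
    (ae_of_all _ fun z => ?_)
  rw [Function.uncurry, Real.norm_of_nonneg (gaussianPDFReal_nonneg _ _ _), gaussianPDFReal]
  refine mul_le_of_le_one_right (by positivity) (Real.exp_le_one_iff.2 ?_)
  exact div_nonpos_of_nonpos_of_nonneg (by nlinarith [sq_nonneg (z.1 - z.2 - 0)]) (by positivity)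

lemma integrable_gaussianReal_Ioc (hv : v ≠ 0) {a x : ℝ} (hax : a ≤ x) :
    Integrable (fun w => (gaussianReal w v).real (Set.Ioc a x)) ν := by
  have hfin : IsFiniteMeasure (volume.restrict (Set.uIoc a x)) :=
    ⟨by rw [Measure.restrict_apply_univ]; simp [Set.uIoc]⟩
  simp only [gaussianReal_Ioc _ hv hax, intervalIntegral.integral_of_le hax]
  rw [← Set.uIoc_of_le hax]
  exact (integrable_gaussianPDFReal_sub_prod v a x).integral_prod_right

lemma gaussianReal_real_abs_sub_ge_le (w : ℝ) (v : NNReal) {h : ℝ} (hh : 0 < h) :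
    (gaussianReal w v).real {s | h ≤ |s - w|} ≤ v / h ^ 2 := by
  have := meas_ge_le_variance_div_sq (memLp_id_gaussianReal' (μ := w) (v := v) 2 (by simp)) hh
  simp only [id, integral_id_gaussianReal] at this
  rw [measureReal_def]
  refine ENNReal.toReal_le_of_le_ofReal (by positivity) (this.trans_eq ?_)
  rw [← variance_id_gaussianReal (μ := w) (v := v)]

/-- The smoothed law and the Edgeworth approximation have close increments if their Fourier
transforms are close. -/
lemma abs_integral_gaussianReal_Ioc_sub_le (hv : v ≠ 0) (c : ℝ)
    (hJ : Integrable fun u : ℝ => ‖charFun ν u * Complex.exp (-(v * u ^ 2 / 2 : ℝ)) -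
      edgeCharFun c u‖ / |u|) {a x : ℝ} (hax : a ≤ x) :
    |∫ w, (gaussianReal w v).real (Set.Ioc a x) ∂ν - (edgeCDF c x - edgeCDF c a)| ≤
      ∫ u : ℝ, ‖charFun ν u * Complex.exp (-(v * u ^ 2 / 2 : ℝ)) - edgeCharFun c u‖ / |u| := by
  have hv' : (0 : ℝ) < v := NNReal.coe_pos.2 (pos_iff_ne_zero.2 hv)
  have hfin : IsFiniteMeasure (volume.restrict (Set.uIoc a x)) :=
      ⟨by rw [Measure.restrict_apply_univ]; simp [Set.uIoc]⟩
  set D : ℝ → ℂ := fun u => charFun ν u * Complex.exp (-(v * u ^ 2 / 2 : ℝ)) - edgeCharFun c u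
    with hDdef
  have hD : Integrable D := (integrable_charFun_mul_exp hv).sub (integrable_edgeCharFun c)
  have hP := integrable_gaussianPDFReal_sub_prod (ν := ν) v a x
  have h1 : ∫ w, (gaussianReal w v).real (Set.Ioc a x) ∂ν =
      ∫ s in a..x, ∫ w, gaussianPDFReal 0 v (s - w) ∂ν := by
    simp only [gaussianReal_Ioc _ hv hax]
    rw [intervalIntegral_integral_swap hP]
  have hint : IntervalIntegrable (fun s => ∫ w, gaussianPDFReal 0 v (s - w) ∂ν) volume a x := by
    rw [intervalIntegrable_iff]
    exact hP.integral_prod_left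
  rw [h1, ← integral_edgePDF, ← intervalIntegral.integral_sub hint
    ((continuous_edgePDF c).intervalIntegrable _ _)]
  have hexp : ∀ (s : ℝ), AEStronglyMeasurable (fun u : ℝ => Complex.exp (-(u * s : ℝ) * Complex.I)) := by
    intro s; fun_prop
  have hexpb : ∀ (s u : ℝ), ‖Complex.exp (-(u * s : ℝ) * Complex.I)‖ ≤ 1 :=
    fun s u => (norm_cexp_neg_ofReal_mul_I (u * s)).le
  have h2 : ∀ s, (2 * Real.pi * ((∫ w, gaussianPDFReal 0 v (s - w) ∂ν) - edgePDF c s : ℝ) : ℂ) =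
      ∫ u, D u * Complex.exp (-(u * s : ℝ) * Complex.I) := by
    intro s
    rw [Complex.ofReal_sub, mul_sub, integral_gaussianPDFReal_sub hv,
      ← integral_edgeCharFun_mul_exp, ← integral_sub]
    · simp only [hDdef, sub_mul]
    · exact (integrable_charFun_mul_exp hv).mul_bdd (hexp s) (ae_of_all _ (hexpb s))
    · exact (integrable_edgeCharFun c).mul_bdd (hexp s) (ae_of_all _ (hexpb s))
  have h3 := norm_integral_integral_exp_le hD hJ a x
  simp only [← h2] at h3
  rw [intervalIntegral.integral_const_mul, intervalIntegral.integral_ofReal, norm_mul,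
    Complex.norm_real, Real.norm_eq_abs] at h3
  have h4 : ‖(2 * Real.pi : ℂ)‖ = 2 * Real.pi := by
    simp [abs_of_pos Real.pi_pos]
  -- This gives the increment bound `J / π`, with `J` the right-hand integral; the factor `1 / π` is
  -- dropped.
  rw [h4] at h3
  have h5 := Real.pi_gt_three
  have h6 := abs_nonneg (∫ s in a..x, ((∫ w, gaussianPDFReal 0 v (s - w) ∂ν) - edgePDF c s))
  nlinarith

/-- Smoothing inequality: a law whose characteristic function is close to `edgeCharFun c` has a
distribution function close to `edgeCDF c`. -/
theorem abs_measureReal_Iio_sub_edgeCDF_le (hv : v ≠ 0) {c : ℝ} (hc : |c| ≤ 1)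
    (hJ : Integrable fun u : ℝ => ‖charFun ν u * Complex.exp (-(v * u ^ 2 / 2 : ℝ)) -
      edgeCharFun c u‖ / |u|) {h : ℝ} (hh : 0 < h) (x : ℝ) :
    |ν.real (Set.Iio x) - edgeCDF c x| ≤
      (∫ u : ℝ, ‖charFun ν u * Complex.exp (-(v * u ^ 2 / 2 : ℝ)) - edgeCharFun c u‖ / |u|) +
        v / h ^ 2 + 11 * h := by
  set J := ∫ u : ℝ, ‖charFun ν u * Complex.exp (-(v * u ^ 2 / 2 : ℝ)) - edgeCharFun c u‖ / |u|
  have hlip : ∀ y z, |edgeCDF c y - edgeCDF c z| ≤ 11 * |y - z| := fun y z => by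
    have := Convex.norm_image_sub_le_of_norm_hasDerivWithin_le (s := Set.univ) (x := z) (y := y)
      (fun t _ => (hasDerivAt_edgeCDF c t).hasDerivWithinAt)
      (fun t _ => abs_edgePDF_le hc t) convex_univ trivial trivial
    simpa using this
  have hl1 := abs_le.1 (hlip (x + h) x)
  have hl2 := abs_le.1 (hlip (x - h) x)
  rw [add_sub_cancel_left, abs_of_pos hh] at hl1
  rw [sub_sub_cancel_left, abs_neg, abs_of_pos hh] at hl2
  have htail : Tendsto (fun a => a + h) atBot atBot := tendsto_atBot_add_const_right _ _ tendsto_id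
  -- A point of `(a + h, x]` leaves `(a, x + h]` under the Gaussian perturbation only by moving at
  -- least `h`, which Chebyshev bounds by `v / h²`.
  have hup : cdf ν x ≤ edgeCDF c (x + h) + J + v / h ^ 2 := by
    have hlim : Tendsto (fun a => edgeCDF c (x + h) - edgeCDF c a + J + v / h ^ 2 + cdf ν (a + h))
        atBot (𝓝 (edgeCDF c (x + h) - 0 + J + v / h ^ 2 + 0)) :=
      (((tendsto_const_nhds.sub (tendsto_edgeCDF_atBot c)).add_const _).add_const _).add
        ((tendsto_cdf_atBot ν).comp htail)
    rw [sub_zero, add_zero] at hlim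
    refine ge_of_tendsto hlim ?_
    filter_upwards [eventually_le_atBot (x - h)] with a ha
    have hax : a ≤ x + h := by linarith
    have h1 := (abs_le.1 (abs_integral_gaussianReal_Ioc_sub_le hv c hJ hax)).2
    have h2 : ν.real (Set.Ioc (a + h) x) - v / h ^ 2 ≤
        ∫ w, (gaussianReal w v).real (Set.Ioc a (x + h)) ∂ν := by
      have h3 : ν.real (Set.Ioc (a + h) x) - v / h ^ 2 =
          ∫ w, ((Set.Ioc (a + h) x).indicator 1 w - v / h ^ 2) ∂ν := by
        rw [integral_sub ((integrable_const 1).indicator measurableSet_Ioc) (integrable_const _),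
          integral_indicator_one measurableSet_Ioc]
        simp
      rw [h3]
      refine integral_mono (((integrable_const 1).indicator measurableSet_Ioc).sub
        (integrable_const _)) (integrable_gaussianReal_Ioc hv hax) fun w => ?_
      by_cases hw : w ∈ Set.Ioc (a + h) x
      · simp only [Set.indicator_of_mem hw, Pi.one_apply]
        have h4 := gaussianReal_real_abs_sub_ge_le w v hh
        have h5 : (Set.Ioc a (x + h))ᶜ ⊆ {s | h ≤ |s - w|} := by
          intro s hs
          by_contra hcon
          simp only [Set.mem_ofPred_eq, not_le, abs_lt] at hcon
          exact hs ⟨by linarith [hw.1], by linarith [hw.2]⟩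
        have h6 := (measureReal_mono h5).trans h4
        rw [probReal_compl_eq_one_sub measurableSet_Ioc] at h6
        linarith
      · simp only [Set.indicator_of_notMem hw]
        have : 0 ≤ v / h ^ 2 := by positivity
        linarith [measureReal_nonneg (μ := gaussianReal w v) (s := Set.Ioc a (x + h))]
    have h7 : cdf ν x ≤ cdf ν (a + h) + ν.real (Set.Ioc (a + h) x) := by
      rw [cdf_eq_real, cdf_eq_real, ← Set.Iic_union_Ioc_eq_Iic (by linarith : a + h ≤ x)]
      exact measureReal_union_le _ _
    linarith
  -- A starting point `w ≥ x` must move at least `h` to reach `(a, x - h]`, so the open half-line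
  -- already suffices for the lower bound.
  have hlo : edgeCDF c (x - h) - J - v / h ^ 2 ≤ ν.real (Set.Iio x) := by
    have hlim : Tendsto (fun a => edgeCDF c (x - h) - edgeCDF c a - J - v / h ^ 2)
        atBot (𝓝 (edgeCDF c (x - h) - 0 - J - v / h ^ 2)) :=
      ((tendsto_const_nhds.sub (tendsto_edgeCDF_atBot c)).sub_const _).sub_const _
    rw [sub_zero] at hlim
    refine le_of_tendsto hlim ?_
    filter_upwards [eventually_le_atBot (x - h)] with a hax
    have h1 := (abs_le.1 (abs_integral_gaussianReal_Ioc_sub_le hv c hJ hax)).1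
    have h2 : ∫ w, (gaussianReal w v).real (Set.Ioc a (x - h)) ∂ν ≤
        ν.real (Set.Iio x) + v / h ^ 2 := by
      have h3 : ν.real (Set.Iio x) + v / h ^ 2 =
          ∫ w, ((Set.Iio x).indicator 1 w + v / h ^ 2) ∂ν := by
        rw [integral_add ((integrable_const 1).indicator measurableSet_Iio) (integrable_const _),
          integral_indicator_one measurableSet_Iio]
        simp
      rw [h3]
      refine integral_mono (integrable_gaussianReal_Ioc hv hax)
        (((integrable_const 1).indicator measurableSet_Iio).add (integrable_const _)) fun w => ?_
      by_cases hw : w ∈ Set.Iio x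
      · simp only [Set.indicator_of_mem hw, Pi.one_apply]
        have : 0 ≤ v / h ^ 2 := by positivity
        linarith [measureReal_le_one (μ := gaussianReal w v) (s := Set.Ioc a (x - h))]
      · simp only [Set.indicator_of_notMem hw, zero_add]
        refine (measureReal_mono ?_).trans (gaussianReal_real_abs_sub_ge_le w v hh)
        intro s hs
        simp only [Set.mem_Iio, not_lt] at hw
        have h4 : h ≤ -(s - w) := by linarith [hs.2]
        exact h4.trans (neg_le_abs _)
    linarith
  have hle : ν.real (Set.Iio x) ≤ cdf ν x := by
    rw [cdf_eq_real]
    exact measureReal_mono Set.Iio_subset_Iic_self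
  rw [abs_le]
  constructor <;> linarith

end Smoothing

/-! ### The cumulant function: expansion at the origin and the Cramér condition. -/

/-- For `|x| ≤ 1` the constant comes from `e ≤ 4`; for `|x| ≥ 1` each term is at most a multiple of
`x⁴`, and `1 + 1 + 1 + 1/2 + 1/6 ≤ 4`. -/
lemma norm_exp_mul_I_taylor_three_le (x : ℝ) :
    ‖Complex.exp (x * Complex.I) - 1 - x * Complex.I + x ^ 2 / 2 - (x * Complex.I) ^ 3 / 6‖ ≤
      4 * x ^ 4 := by
  have hx4 : x ^ 4 = |x| ^ 4 := by rw [← abs_pow, abs_of_nonneg (by positivity)]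
  have h0 := abs_nonneg x
  have hexp := Complex.norm_exp_ofReal_mul_I x
  rcases le_total |x| 1 with h | h
  · have h1 := Complex.norm_exp_sub_sum_le_norm_mul_exp (x * Complex.I) 4
    have h2 : ∑ m ∈ Finset.range 4, (x * Complex.I) ^ m / (m ! : ℂ) =
        1 + x * Complex.I - x ^ 2 / 2 + (x * Complex.I) ^ 3 / 6 := by
      simp [Finset.sum_range_succ, Nat.factorial, mul_pow]
      ring
    have h3 : ‖(x * Complex.I : ℂ)‖ = |x| := by simp
    rw [h2, h3] at h1
    have h4 : Real.exp |x| ≤ 4 := (Real.exp_le_exp.2 h).trans (by linarith [Real.exp_one_lt_d9])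
    have h5 : Complex.exp (x * Complex.I) - 1 - x * Complex.I + x ^ 2 / 2 - (x * Complex.I) ^ 3 / 6 =
        Complex.exp (x * Complex.I) -
          (1 + x * Complex.I - x ^ 2 / 2 + (x * Complex.I) ^ 3 / 6) := by ring
    rw [h5, hx4]
    refine h1.trans ?_
    rw [mul_comm]
    gcongr
  · have e1 : ‖(x * Complex.I : ℂ)‖ = |x| := by simp
    have e2 : ‖((x : ℂ) ^ 2 / 2)‖ = |x| ^ 2 / 2 := by simp
    have e3 : ‖((x * Complex.I : ℂ) ^ 3 / 6)‖ = |x| ^ 3 / 6 := by simp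
    have h1 : ‖Complex.exp (x * Complex.I) - 1 - x * Complex.I + x ^ 2 / 2 -
        (x * Complex.I) ^ 3 / 6‖ ≤ 1 + 1 + |x| + |x| ^ 2 / 2 + |x| ^ 3 / 6 := by
      refine (norm_sub_le _ _).trans ?_
      rw [e3]
      gcongr
      refine (norm_add_le _ _).trans ?_
      rw [e2]
      gcongr
      refine (norm_sub_le _ _).trans ?_
      rw [e1]
      gcongr
      refine (norm_sub_le _ _).trans ?_
      rw [hexp, norm_one]
    have p1 : |x| ≤ |x| ^ 4 := by simpa using pow_le_pow_right₀ h (show 1 ≤ 4 by norm_num)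
    have p2 : |x| ^ 2 ≤ |x| ^ 4 := pow_le_pow_right₀ h (by norm_num)
    have p3 : |x| ^ 3 ≤ |x| ^ 4 := pow_le_pow_right₀ h (by norm_num)
    have p0 : 1 ≤ |x| ^ 4 := one_le_pow₀ h
    rw [hx4]
    linarith

/-- Transfers a lower bound on `∫ sin²` from the frequency `kv` to `v`, at the cost of a factor
`k²`. -/
lemma abs_sin_natCast_mul_le (k : ℕ) (x : ℝ) : |Real.sin (k * x)| ≤ k * |Real.sin x| := by
  induction k with
  | zero => simp
  | succ k ih =>
    push_cast
    rw [add_mul, one_mul, Real.sin_add]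
    calc _ ≤ |Real.sin (k * x) * Real.cos x| + |Real.cos (k * x) * Real.sin x| := abs_add_le _ _
      _ ≤ |Real.sin (k * x)| * 1 + 1 * |Real.sin x| := by
        rw [abs_mul, abs_mul]
        gcongr
        · exact Real.abs_cos_le_one _
        · exact Real.abs_cos_le_one _
      _ ≤ _ := by linarith

section Cumulant

variable {μ : Measure ℝ} {g : ℝ → ℝ}

/-- The cumulant function of the centred integral of `g` with respect to a Poisson process with
intensity measure `μ`. -/
noncomputable def cumulant (μ : Measure ℝ) (g : ℝ → ℝ) (t : ℝ) : ℂ :=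
  ∫ x, (Complex.exp (t * g x * Complex.I) - 1 - t * g x * Complex.I) ∂μ

lemma integrable_exp_sub_one (hg : Measurable g) (h1 : Integrable g μ) (t : ℝ) :
    Integrable (fun x => Complex.exp (t * g x * Complex.I) - 1) μ := by
  refine (h1.norm.const_mul |t|).mono' (by fun_prop) (ae_of_all _ fun x => ?_)
  have := norm_exp_mul_I_sub_le (t * g x) 0
  simpa using this

lemma integrable_cumulant (hg : Measurable g) (h1 : Integrable g μ) (t : ℝ) :
    Integrable (fun x => Complex.exp (t * g x * Complex.I) - 1 - t * g x * Complex.I) μ :=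
  (integrable_exp_sub_one hg h1 t).sub ((h1.ofReal.const_mul _).mul_const _)

lemma cumulant_eq (hg : Measurable g) (h1 : Integrable g μ) (t : ℝ) :
    cumulant μ g t = ∫ x, (Complex.exp (t * g x * Complex.I) - 1) ∂μ -
      t * (∫ x, g x ∂μ : ℝ) * Complex.I := by
  have i1 : Integrable (fun x => (t : ℂ) * (g x : ℂ) * Complex.I) μ :=
    (h1.ofReal.const_mul _).mul_const _
  rw [cumulant, integral_sub (integrable_exp_sub_one hg h1 t) i1,
    integral_mul_const, integral_const_mul, integral_complex_ofReal]

lemma norm_cumulant_sub_le (hg : Measurable g) (h1 : Integrable g μ)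
    (h2 : Integrable (fun x => g x ^ 2) μ) (h3 : Integrable (fun x => g x ^ 3) μ)
    (h4 : Integrable (fun x => g x ^ 4) μ) (t : ℝ) :
    ‖cumulant μ g t + t ^ 2 / 2 * (∫ x, g x ^ 2 ∂μ : ℝ) -
      (t * Complex.I) ^ 3 / 6 * (∫ x, g x ^ 3 ∂μ : ℝ)‖ ≤ 4 * t ^ 4 * ∫ x, g x ^ 4 ∂μ := by
  have i2 : Integrable (fun x => (t ^ 2 / 2 : ℂ) * ((g x ^ 2 : ℝ) : ℂ)) μ := h2.ofReal.const_mul _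
  have i3 : Integrable (fun x => ((t * Complex.I) ^ 3 / 6 : ℂ) * ((g x ^ 3 : ℝ) : ℂ)) μ :=
    h3.ofReal.const_mul _
  have i12 : Integrable (fun x => Complex.exp (t * g x * Complex.I) - 1 - t * g x * Complex.I +
      (t ^ 2 / 2 : ℂ) * ((g x ^ 2 : ℝ) : ℂ)) μ := (integrable_cumulant hg h1 t).add i2
  rw [← integral_complex_ofReal, ← integral_complex_ofReal, ← integral_const_mul,
    ← integral_const_mul, cumulant, ← integral_add (integrable_cumulant hg h1 t) i2,
    ← integral_sub i12 i3, ← integral_const_mul]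
  refine norm_integral_le_of_norm_le (h4.const_mul _) (ae_of_all _ fun x => ?_)
  have := norm_exp_mul_I_taylor_three_le (t * g x)
  push_cast at this ⊢
  refine le_trans (le_of_eq ?_) (this.trans (le_of_eq (by ring)))
  congr 1
  ring

/-- Uses `1 - cos a = 2 sin² (a/2)`. The modulus of the characteristic function depends only on this
real part, so the Cramér condition enters here. -/
lemma re_cumulant (hg : Measurable g) (h1 : Integrable g μ) (t : ℝ) :
    (cumulant μ g t).re = -2 * ∫ x, Real.sin (t / 2 * g x) ^ 2 ∂μ := by
  have h := integral_re (integrable_cumulant hg h1 t)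
  simp only [RCLike.re_eq_complex_re] at h
  rw [cumulant, ← h, ← integral_const_mul]
  congr 1
  ext x
  have : (t * g x * Complex.I : ℂ) = ((t * g x : ℝ) : ℂ) * Complex.I := by push_cast; ring
  rw [this, Complex.sub_re, Complex.sub_re, Complex.exp_ofReal_mul_I_re, Complex.re_ofReal_mul,
    Complex.I_re, Complex.one_re, Real.sin_sq_eq_half_sub]
  ring_nf

lemma integrable_sin_sq (hg : Measurable g) (h2 : Integrable (fun x => g x ^ 2) μ) (v : ℝ) :
    Integrable (fun x => Real.sin (v * g x) ^ 2) μ := by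
  refine (h2.const_mul (v ^ 2)).mono' (by fun_prop) (ae_of_all _ fun x => ?_)
  rw [Real.norm_of_nonneg (sq_nonneg _), ← mul_pow, sq_le_sq]
  exact Real.abs_sin_le_abs

/-- A Cramér condition at infinity implies the same condition away from the origin. -/
lemma exists_le_integral_sin_sq (hg : Measurable g) (h2 : Integrable (fun x => g x ^ 2) μ)
    {c₀ V : ℝ} (hc₀ : 0 < c₀) (hC : ∀ v, V < |v| → c₀ ≤ ∫ x, Real.sin (v * g x) ^ 2 ∂μ)
    {ε : ℝ} (hε : 0 < ε) :
    ∃ κ, 0 < κ ∧ ∀ v, ε ≤ |v| → κ ≤ ∫ x, Real.sin (v * g x) ^ 2 ∂μ := by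
  -- With `k ε > |V|`, every `|v| ≥ ε` is pushed by `k` into the range where the condition is
  -- assumed.
  obtain ⟨k, hk⟩ := exists_nat_gt (|V| / ε)
  have hk0 : (0 : ℝ) < k := lt_of_le_of_lt (by positivity) hk
  refine ⟨c₀ / k ^ 2, by positivity, fun v hv => ?_⟩
  have h1 : V < |k * v| := by
    rw [abs_mul, Nat.abs_cast]
    rw [div_lt_iff₀ hε] at hk
    calc V ≤ |V| := le_abs_self V
      _ < k * ε := hk
      _ ≤ k * |v| := by gcongr
  rw [div_le_iff₀ (by positivity), mul_comm, ← integral_const_mul]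
  refine (hC _ h1).trans (integral_mono (integrable_sin_sq hg h2 _)
    ((integrable_sin_sq hg h2 _).const_mul _) fun x => ?_)
  simp only
  rw [← mul_pow, sq_le_sq, mul_assoc, abs_mul, Nat.abs_cast]
  exact abs_sin_natCast_mul_le k _

end Cumulant

/-! ### Comparison of characteristic functions at low and high frequencies. -/

section CharFunComparison

variable {μ : Measure ℝ} {g : ℝ → ℝ}

/-- The Taylor bound for `cumulant` at `t = u / (s q)`, multiplied by `s²`; later `s = √n` and `q =
√a₂`. -/
lemma norm_scaled_cumulant_sub_le (hg : Measurable g) (h1 : Integrable g μ)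
    (h2 : Integrable (fun x => g x ^ 2) μ) (h3 : Integrable (fun x => g x ^ 3) μ)
    (h4 : Integrable (fun x => g x ^ 4) μ) {q s : ℝ} (hq : 0 < q) (hs : 0 < s)
    (hq2 : ∫ x, g x ^ 2 ∂μ = q ^ 2) (u : ℝ) :
    ‖s ^ 2 * cumulant μ g (u / (s * q)) - (-(u ^ 2 / 2 : ℝ) +
      ((∫ x, g x ^ 3 ∂μ) / (6 * q ^ 3) / s : ℝ) * (u * Complex.I) ^ 3)‖ ≤
      4 * (∫ x, g x ^ 4 ∂μ) / q ^ 4 * u ^ 4 / s ^ 2 := by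
  have h := norm_cumulant_sub_le hg h1 h2 h3 h4 (u / (s * q))
  have h' := mul_le_mul_of_nonneg_left h (sq_nonneg s)
  have e : ‖((s : ℂ) ^ 2)‖ = s ^ 2 := by simp
  rw [← e, ← norm_mul, e, hq2] at h'
  have hsc : (s : ℂ) ≠ 0 := by exact_mod_cast hs.ne'
  have hqc : (q : ℂ) ≠ 0 := by exact_mod_cast hq.ne'
  refine le_trans (le_of_eq ?_) (h'.trans (le_of_eq ?_))
  · congr 1
    push_cast
    field_simp
    ring
  · field_simp

/-- Comparison of characteristic functions near the origin. -/
lemma norm_exp_sub_edgeCharFun_le {K : ℂ} {k c M ε s u : ℝ} (hs : 0 < s) (hM : 0 ≤ M)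
    (hK : ‖K - (-(u ^ 2 / 2 : ℝ) + (c / s : ℝ) * (u * Complex.I) ^ 3)‖ ≤ M * u ^ 4 / s ^ 2)
    (hc : |c| ≤ k) (hε : ε * (k + M * ε) ≤ 1 / 4) (hu : |u| ≤ ε * s) :
    ‖Complex.exp K - edgeCharFun (c / s) u‖ ≤
      ((k + M * ε) ^ 2 * |u| ^ 6 + M * |u| ^ 4) * Real.exp (-(1 / 4 * u ^ 2)) / s ^ 2 := by
  have hk : 0 ≤ k := (abs_nonneg c).trans hc
  have h0 := abs_nonneg u
  have hε0 : 0 ≤ ε := by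
    by_contra hneg
    push Not at hneg
    nlinarith
  have hu4 : u ^ 4 = |u| ^ 4 := by rw [← abs_pow, abs_of_nonneg (by positivity)]
  have hu2 : u ^ 2 = |u| ^ 2 := (sq_abs u).symm
  set R := K - (-(u ^ 2 / 2 : ℝ) + (c / s : ℝ) * (u * Complex.I) ^ 3) with hR
  set z := (c / s : ℝ) * (u * Complex.I) ^ 3 + R with hz
  have hKz : K = -(u ^ 2 / 2 : ℝ) + z := by rw [hz, hR]; ring
  have hR' : ‖R‖ ≤ M * ε * |u| ^ 3 / s := by
    refine hK.trans ?_
    rw [hu4, div_le_div_iff₀ (by positivity) hs]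
    calc M * |u| ^ 4 * s = M * |u| ^ 3 * s * |u| := by ring
      _ ≤ M * |u| ^ 3 * s * (ε * s) := by gcongr
      _ = _ := by ring
  have hz1 : ‖z‖ ≤ (k + M * ε) * |u| ^ 3 / s := by
    refine (norm_add_le _ _).trans ?_
    have : ‖((c / s : ℝ) : ℂ) * (u * Complex.I) ^ 3‖ ≤ k * |u| ^ 3 / s := by
      rw [norm_mul, norm_pow, norm_mul, Complex.norm_I, mul_one, Complex.norm_real,
        Complex.norm_real, Real.norm_eq_abs, Real.norm_eq_abs, abs_div, abs_of_pos hs]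
      rw [div_mul_eq_mul_div]
      gcongr
    calc _ ≤ k * |u| ^ 3 / s + M * ε * |u| ^ 3 / s := add_le_add this hR'
      _ = _ := by ring
  -- The smallness of `ε` keeps `‖z‖` below half of the Gaussian exponent, so `e^{-u²/2} e^{‖z‖} ≤
  -- e^{-u²/4}` stays integrable.
  have hz2 : ‖z‖ ≤ u ^ 2 / 4 := by
    refine hz1.trans ?_
    rw [div_le_iff₀ hs, hu2]
    calc (k + M * ε) * |u| ^ 3 = (k + M * ε) * |u| ^ 2 * |u| := by ring
      _ ≤ (k + M * ε) * |u| ^ 2 * (ε * s) := by gcongr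
      _ = (ε * (k + M * ε)) * (|u| ^ 2 * s) := by ring
      _ ≤ 1 / 4 * (|u| ^ 2 * s) := by gcongr
      _ = _ := by ring
  have hexp := Complex.norm_exp_sub_sum_le_norm_mul_exp z 2
  have hsum : ∑ m ∈ Finset.range 2, z ^ m / (m ! : ℂ) = 1 + z := by
    simp [Finset.sum_range_succ]
  rw [hsum] at hexp
  have hdiff : Complex.exp K - edgeCharFun (c / s) u =
      Complex.exp (-(u ^ 2 / 2 : ℝ)) * ((Complex.exp z - (1 + z)) + R) := by
    rw [hKz, Complex.exp_add, edgeCharFun, hz]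
    ring
  rw [hdiff, norm_mul, norm_cexp_neg_ofReal]
  have hb : ‖(Complex.exp z - (1 + z)) + R‖ ≤
      ((k + M * ε) ^ 2 * |u| ^ 6 + M * |u| ^ 4) / s ^ 2 * Real.exp (u ^ 2 / 4) := by
    have e1 : 1 ≤ Real.exp (u ^ 2 / 4) := Real.one_le_exp (by positivity)
    calc _ ≤ ‖z‖ ^ 2 * Real.exp ‖z‖ + ‖R‖ := (norm_add_le _ _).trans (by gcongr)
      _ ≤ ((k + M * ε) * |u| ^ 3 / s) ^ 2 * Real.exp (u ^ 2 / 4) +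
          M * |u| ^ 4 / s ^ 2 * Real.exp (u ^ 2 / 4) := by
        gcongr
        rw [hu4] at hK
        exact hK.trans (le_mul_of_one_le_right (by positivity) e1)
      _ = _ := by ring
  calc _ ≤ Real.exp (-(u ^ 2 / 2)) *
        (((k + M * ε) ^ 2 * |u| ^ 6 + M * |u| ^ 4) / s ^ 2 * Real.exp (u ^ 2 / 4)) := by gcongr
    _ = ((k + M * ε) ^ 2 * |u| ^ 6 + M * |u| ^ 4) / s ^ 2 *
        (Real.exp (-(u ^ 2 / 2)) * Real.exp (u ^ 2 / 4)) := by ring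
    _ = _ := by
      rw [← Real.exp_add, div_mul_eq_mul_div]
      ring_nf

/-- The integrable majorant of the error in the comparison of characteristic functions. -/
noncomputable def charFunMajorant (k M ε u : ℝ) : ℝ :=
  ((k + M * ε) ^ 2 * |u| ^ 5 + M * |u| ^ 3) * Real.exp (-(1 / 4 * u ^ 2)) +
    (1 + 1 / ε ^ 2) * (|u| ^ 1 + k * |u| ^ 4) * Real.exp (-(1 / 2 * u ^ 2))

lemma integrable_charFunMajorant (k M ε : ℝ) : Integrable (charFunMajorant k M ε) := by
  have i := fun m => integrable_abs_pow_mul_exp (b := 1 / 4) (by norm_num) m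
  have j := fun m => integrable_abs_pow_mul_exp (b := 1 / 2) (by norm_num) m
  refine ((((i 5).const_mul ((k + M * ε) ^ 2)).add ((i 3).const_mul M)).add
    (((j 1).const_mul (1 + 1 / ε ^ 2)).add ((j 4).const_mul ((1 + 1 / ε ^ 2) * k)))).congr
    (ae_of_all _ fun u => ?_)
  simp only [Pi.add_apply, charFunMajorant]
  ring

lemma one_sub_exp_neg_le (x : ℝ) : 1 - Real.exp (-x) ≤ x := by
  linarith [Real.add_one_le_exp (-x)]

/-- Comparison of the smoothed characteristic functions. -/
lemma norm_exp_mul_sub_edgeCharFun_div_le {K : ℂ} {k c M ε s u v κ : ℝ} (hs : 1 ≤ s) (hM : 0 ≤ M)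
    (hK : ‖K - (-(u ^ 2 / 2 : ℝ) + (c / s : ℝ) * (u * Complex.I) ^ 3)‖ ≤ M * u ^ 4 / s ^ 2)
    (hc : |c| ≤ k) (hε0 : 0 < ε) (hε : ε * (k + M * ε) ≤ 1 / 4) (hv0 : 0 ≤ v) (hv : v ≤ 1 / s ^ 2)
    (hKre : ε * s ≤ |u| → K.re ≤ -κ) :
    ‖Complex.exp K * Complex.exp (-(v * u ^ 2 / 2 : ℝ)) - edgeCharFun (c / s) u‖ / |u| ≤
      1 / s ^ 2 * charFunMajorant k M ε u +
        Real.exp (-κ) / ε * (|u| ^ 0 * Real.exp (-(v / 2 * u ^ 2))) := by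
  have hk : 0 ≤ k := (abs_nonneg c).trans hc
  have hs0 : 0 < s := by linarith
  rcases eq_or_ne u 0 with rfl | hu
  -- At `u = 0` the quotient is `0` by the convention for division by zero.
  · have := Real.exp_pos (-κ)
    simp [charFunMajorant]
    positivity
  have hu0 : 0 < |u| := abs_pos.2 hu
  have hu2 : u ^ 2 = |u| ^ 2 := (sq_abs u).symm
  have hγ : ‖edgeCharFun (c / s) u‖ ≤ Real.exp (-(1 / 2 * u ^ 2)) * (1 + k * |u| ^ 3) := by
    refine (norm_edgeCharFun_le _ _).trans ?_
    have e : u ^ 2 / 2 = 1 / 2 * u ^ 2 := by ring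
    rw [e]
    gcongr
    rw [abs_div, abs_of_pos hs0]
    exact (div_le_self (abs_nonneg c) hs).trans hc
  have hω1 : Real.exp (-(v * u ^ 2 / 2)) ≤ 1 := Real.exp_le_one_iff.2 (by
    have : 0 ≤ v * u ^ 2 / 2 := by positivity
    linarith)
  have hω0 := Real.exp_pos (-(v * u ^ 2 / 2))
  have hE2 : 0 ≤ Real.exp (-κ) / ε * (|u| ^ 0 * Real.exp (-(v / 2 * u ^ 2))) := by positivity
  rw [div_le_iff₀ hu0]
  rcases le_total |u| (ε * s) with hcase | hcase
  · have h1 := norm_exp_sub_edgeCharFun_le hs0 hM hK hc hε hcase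
    -- Separates the error of the expansion from the effect of the smoothing factor, which is at
    -- most `v u² / 2` away from `1`.
    have h2 : Complex.exp K * Complex.exp (-(v * u ^ 2 / 2 : ℝ)) - edgeCharFun (c / s) u =
        (Complex.exp K - edgeCharFun (c / s) u) * Complex.exp (-(v * u ^ 2 / 2 : ℝ)) -
          edgeCharFun (c / s) u * ((1 - Real.exp (-(v * u ^ 2 / 2)) : ℝ) : ℂ) := by
      push_cast; ring
    have h3 : ‖((1 - Real.exp (-(v * u ^ 2 / 2)) : ℝ) : ℂ)‖ ≤ 1 / s ^ 2 * |u| ^ 2 := by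
      rw [Complex.norm_real, Real.norm_of_nonneg (by linarith)]
      refine (one_sub_exp_neg_le _).trans ?_
      rw [hu2]
      have : v * |u| ^ 2 ≤ 1 / s ^ 2 * |u| ^ 2 := by gcongr
      have : 0 ≤ v * |u| ^ 2 := by positivity
      linarith
    calc _ ≤ ‖Complex.exp K - edgeCharFun (c / s) u‖ * 1 +
          ‖edgeCharFun (c / s) u‖ * (1 / s ^ 2 * |u| ^ 2) := by
          rw [h2]
          refine (norm_sub_le _ _).trans ?_
          rw [norm_mul, norm_mul, norm_cexp_neg_ofReal]
          gcongr
      _ ≤ ((k + M * ε) ^ 2 * |u| ^ 6 + M * |u| ^ 4) * Real.exp (-(1 / 4 * u ^ 2)) / s ^ 2 * 1 +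
          Real.exp (-(1 / 2 * u ^ 2)) * (1 + k * |u| ^ 3) * (1 / s ^ 2 * |u| ^ 2) := by gcongr
      _ ≤ ((k + M * ε) ^ 2 * |u| ^ 6 + M * |u| ^ 4) * Real.exp (-(1 / 4 * u ^ 2)) / s ^ 2 * 1 +
          (1 + 1 / ε ^ 2) *
            (Real.exp (-(1 / 2 * u ^ 2)) * (1 + k * |u| ^ 3) * (1 / s ^ 2 * |u| ^ 2)) := by
          -- The factor `1 + 1 / ε²` is inserted only to share one majorant with the high-frequency
          -- case.
          refine add_le_add le_rfl (le_mul_of_one_le_left (by positivity) ?_)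
          have : 0 ≤ 1 / ε ^ 2 := by positivity
          linarith
      _ = 1 / s ^ 2 * charFunMajorant k M ε u * |u| := by
          rw [charFunMajorant]; ring
      _ ≤ _ := mul_le_mul_of_nonneg_right (by linarith) hu0.le
  · have h1 : ‖Complex.exp K‖ ≤ Real.exp (-κ) := by
      rw [Complex.norm_exp]; exact Real.exp_le_exp.2 (hKre hcase)
    have hone : 1 ≤ |u| / (ε * s) := (one_le_div (by positivity)).2 hcase
    have hone' : 1 ≤ |u| / ε := (one_le_div hε0).2
      ((le_mul_of_one_le_right hε0.le hs).trans hcase)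
    have e1 : v * u ^ 2 / 2 = v / 2 * u ^ 2 := by ring
    calc _ ≤ Real.exp (-κ) * Real.exp (-(v / 2 * u ^ 2)) +
          Real.exp (-(1 / 2 * u ^ 2)) * (1 + k * |u| ^ 3) := by
          refine (norm_sub_le _ _).trans ?_
          rw [norm_mul, norm_cexp_neg_ofReal, e1]
          gcongr
      _ ≤ Real.exp (-κ) * Real.exp (-(v / 2 * u ^ 2)) * (|u| / ε) +
          Real.exp (-(1 / 2 * u ^ 2)) * (1 + k * |u| ^ 3) * (|u| / (ε * s)) ^ 2 := by
          -- Both inserted factors are at least `1`: `|u| / ε` pays for the division by `|u|`, and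
          -- the square of `|u| / (ε s)` yields the factor `1 / s²`.
          refine add_le_add (le_mul_of_one_le_right (by positivity) hone')
            (le_mul_of_one_le_right (by positivity) (one_le_pow₀ hone))
      _ = Real.exp (-κ) * Real.exp (-(v / 2 * u ^ 2)) * (|u| / ε) + 1 / s ^ 2 *
          ((0 + (1 / ε ^ 2) * (|u| ^ 1 + k * |u| ^ 4) * Real.exp (-(1 / 2 * u ^ 2))) * |u|) := by
          field_simp
          ring
      _ ≤ Real.exp (-κ) * Real.exp (-(v / 2 * u ^ 2)) * (|u| / ε) +
          1 / s ^ 2 * (charFunMajorant k M ε u * |u|) := by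
          rw [charFunMajorant]
          gcongr
          · positivity
          · linarith
      _ = _ := by ring

end CharFunComparison

/-! ### The Edgeworth expansion of standardized sums. -/

lemma eventually_sq_mul_exp_neg_le {b : ℝ} (hb : 0 < b) :
    ∀ᶠ n : ℕ in atTop, (n : ℝ) ^ 2 * Real.exp (-(b * n)) ≤ 1 / n := by
  have h1 : Tendsto (fun n : ℕ => b * (n : ℝ)) atTop atTop :=
    tendsto_natCast_atTop_atTop.const_mul_atTop hb
  have h := (Real.tendsto_pow_mul_exp_neg_atTop_nhds_zero 3).comp h1
  filter_upwards [h.eventually_le_const (show 0 < b ^ 3 by positivity), eventually_gt_atTop 0]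
    with n hn hn0
  have hn0' : (0 : ℝ) < n := by exact_mod_cast hn0
  simp only [Function.comp_apply, mul_pow] at hn
  rw [le_div_iff₀ hn0']
  have h2 : b ^ 3 * ((n : ℝ) ^ 2 * Real.exp (-(b * n)) * n) ≤ b ^ 3 * 1 := by
    calc _ = b ^ 3 * (n : ℝ) ^ 3 * Real.exp (-(b * n)) := by ring
      _ ≤ _ := by rw [mul_one]; exact hn
  exact le_of_mul_le_mul_left h2 (by positivity)

/-- Edgeworth expansion, with error `O(1 / n)`, for centred and normalized sums of integrals with
respect to Poisson processes. -/
theorem exists_abs_measureReal_Iio_sub_edgeCDF_le {μ : Measure ℝ} {g : ℝ → ℝ} (hg : Measurable g)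
    (h1 : Integrable g μ) (h2 : Integrable (fun x => g x ^ 2) μ)
    (h3 : Integrable (fun x => g x ^ 3) μ) (h4 : Integrable (fun x => g x ^ 4) μ) {q : ℝ}
    (hq : 0 < q) (hq2 : ∫ x, g x ^ 2 ∂μ = q ^ 2) {c₀ V : ℝ} (hc₀ : 0 < c₀)
    (hC : ∀ v, V < |v| → c₀ ≤ ∫ x, Real.sin (v * g x) ^ 2 ∂μ) :
    ∃ C, ∀ᶠ n : ℕ in atTop, ∀ (ν : Measure ℝ) [IsProbabilityMeasure ν],
      (∀ u : ℝ, charFun ν u = Complex.exp (n * cumulant μ g (u / (√n * q)))) →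
      ∀ x, |ν.real (Set.Iio x) - edgeCDF ((∫ x, g x ^ 3 ∂μ) / (6 * q ^ 3) / √n) x| ≤ C / n := by
  set c := (∫ x, g x ^ 3 ∂μ) / (6 * q ^ 3) with hc
  set k := |c|
  set M := 4 * (∫ x, g x ^ 4 ∂μ) / q ^ 4 with hM
  have hM0 : 0 ≤ M := by
    have : 0 ≤ ∫ x, g x ^ 4 ∂μ := integral_nonneg fun x => by positivity
    positivity
  have hk0 : 0 ≤ k := abs_nonneg c
  obtain ⟨ε, hε0, hε⟩ : ∃ ε : ℝ, 0 < ε ∧ ε * (k + M * ε) ≤ 1 / 4 := by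
    -- This `ε` is at most `1`, so `ε (k + M ε) ≤ ε (k + M) ≤ 1/4`.
    refine ⟨1 / (4 * (k + M + 1)), by positivity, ?_⟩
    have e1 : 1 / (4 * (k + M + 1)) ≤ 1 := (div_le_one (by positivity)).2 (by linarith)
    calc 1 / (4 * (k + M + 1)) * (k + M * (1 / (4 * (k + M + 1))))
        ≤ 1 / (4 * (k + M + 1)) * (k + M * 1) := by gcongr
      _ ≤ 1 / 4 := by
        rw [div_mul_eq_mul_div, div_le_div_iff₀ (by positivity) (by norm_num)]
        linarith
  -- The real part of the cumulant at `u / (s q)` involves the frequency `u / (2 s q)`, which is at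
  -- least `ε / (2q)` in modulus when `|u| ≥ ε s`.
  obtain ⟨κ, hκ0, hκ⟩ := exists_le_integral_sin_sq hg h2 hc₀ hC
    (show 0 < ε / (2 * q) by positivity)
  -- The terms are the low- and high-frequency parts of the inversion integral, then `12 = 11 + 1`
  -- for the Lipschitz and Chebyshev costs.
  refine ⟨(∫ u, charFunMajorant k M ε u) + √(2 * Real.pi) / ε + 12, ?_⟩
  have hsq : Tendsto (fun n : ℕ => √(n : ℝ)) atTop atTop :=
    Real.tendsto_sqrt_atTop.comp tendsto_natCast_atTop_atTop
  filter_upwards [eventually_sq_mul_exp_neg_le (show 0 < 2 * κ by positivity),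
    eventually_ge_atTop 1, hsq.eventually_ge_atTop k] with n hn hn1 hnk ν _ hν x
  have hn1' : (1 : ℝ) ≤ n := by exact_mod_cast hn1
  have hn0 : (0 : ℝ) < n := by linarith
  set s := √(n : ℝ) with hs
  have hs1 : 1 ≤ s := Real.one_le_sqrt.2 hn1'
  have hs0 : 0 < s := by linarith
  have hs2 : s ^ 2 = n := Real.sq_sqrt hn0.le
  -- With `v = n⁻⁴` and shift `h = 1/n`, Chebyshev costs `v / h² = n⁻²`, while the Gaussian integral
  -- `√(2π) n²` is absorbed by `e^{-2κn}`.
  set v : NNReal := ((n : NNReal) ^ 4)⁻¹ with hv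
  have hvr : (v : ℝ) = ((n : ℝ) ^ 4)⁻¹ := by simp [hv]
  have hn0' : (n : NNReal) ≠ 0 := by
    have : n ≠ 0 := by omega
    exact_mod_cast this
  have hv0 : v ≠ 0 := inv_ne_zero (pow_ne_zero _ hn0')
  have hv1 : (v : ℝ) ≤ 1 / s ^ 2 := by
    rw [hvr, hs2, one_div]
    exact inv_anti₀ hn0 (le_self_pow₀ hn1' (by norm_num))
  have hbound : ∀ u : ℝ, ‖charFun ν u * Complex.exp (-(v * u ^ 2 / 2 : ℝ)) -
      edgeCharFun (c / s) u‖ / |u| ≤ 1 / s ^ 2 * charFunMajorant k M ε u +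
        Real.exp (-(2 * κ * n)) / ε * (|u| ^ 0 * Real.exp (-(v / 2 * u ^ 2))) := by
    intro u
    rw [hν u]
    refine norm_exp_mul_sub_edgeCharFun_div_le hs1 hM0 ?_ le_rfl hε0 hε v.2 hv1 fun hu => ?_
    · have := norm_scaled_cumulant_sub_le hg h1 h2 h3 h4 hq hs0 hq2 u
      rw [← Complex.ofReal_pow, hs2] at this
      rw [hs2]
      exact_mod_cast this
    · have e : ((n : ℂ) * cumulant μ g (u / (s * q))).re = n * (cumulant μ g (u / (s * q))).re := by
        rw [← Complex.ofReal_natCast, Complex.re_ofReal_mul]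
      rw [e, re_cumulant hg h1]
      have hv' : ε / (2 * q) ≤ |u / (s * q) / 2| := by
        rw [abs_div, abs_div, abs_of_pos (by positivity : 0 < s * q), abs_of_pos (two_pos (α := ℝ)),
          div_div, div_le_div_iff₀ (by positivity) (by positivity)]
        calc ε * (s * q * 2) = ε * s * (2 * q) := by ring
          _ ≤ |u| * (2 * q) := by gcongr
      have := mul_le_mul_of_nonneg_left (hκ _ hv') hn0.le
      linarith
  have hgint := integrable_abs_pow_mul_exp (b := v / 2) (by rw [hvr]; positivity) 0
  have hmaj : Integrable fun u : ℝ => 1 / s ^ 2 * charFunMajorant k M ε u +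
        Real.exp (-(2 * κ * n)) / ε * (|u| ^ 0 * Real.exp (-(v / 2 * u ^ 2))) :=
    ((integrable_charFunMajorant k M ε).const_mul _).add (hgint.const_mul _)
  have hJ : Integrable fun u : ℝ => ‖charFun ν u * Complex.exp (-(v * u ^ 2 / 2 : ℝ)) -
      edgeCharFun (c / s) u‖ / |u| := by
    refine hmaj.mono' ?_ (ae_of_all _ fun u => ?_)
    · have m1 := measurable_charFun (μ := ν)
      have m2 := (continuous_edgeCharFun (c / s)).measurable
      have : Measurable fun u : ℝ => ‖charFun ν u * Complex.exp (-(v * u ^ 2 / 2 : ℝ)) -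
        edgeCharFun (c / s) u‖ / |u| := by fun_prop
      exact this.aestronglyMeasurable
    · rw [Real.norm_of_nonneg (by positivity)]
      exact hbound u
  have hcs : |c / s| ≤ 1 := by
    rw [abs_div, abs_of_pos hs0]
    exact (div_le_one hs0).2 hnk
  have hfinal := abs_measureReal_Iio_sub_edgeCDF_le (ν := ν) hv0 hcs hJ
    (show 0 < 1 / (n : ℝ) by positivity) x
  have hJle : ∫ u : ℝ, ‖charFun ν u * Complex.exp (-(v * u ^ 2 / 2 : ℝ)) -
      edgeCharFun (c / s) u‖ / |u| ≤ 1 / n * (∫ u, charFunMajorant k M ε u) +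
        √(2 * Real.pi) / ε * (1 / n) := by
    refine (integral_mono hJ hmaj hbound).trans ?_
    rw [integral_add ((integrable_charFunMajorant k M ε).const_mul _) (hgint.const_mul _),
      integral_const_mul, integral_const_mul, hs2]
    have hgi : ∫ u : ℝ, |u| ^ 0 * Real.exp (-(v / 2 * u ^ 2)) = √(2 * Real.pi) * n ^ 2 := by
      have := integral_gaussian (v / 2 : ℝ)
      simp only [pow_zero, one_mul, ← neg_mul]
      rw [this, hvr]
      have : Real.pi / (((n : ℝ) ^ 4)⁻¹ / 2) = 2 * Real.pi * ((n : ℝ) ^ 2) ^ 2 := by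
        field_simp
      rw [this, Real.sqrt_mul (by positivity), Real.sqrt_sq (by positivity)]
    rw [hgi]
    have := mul_le_mul_of_nonneg_left hn (show 0 ≤ √(2 * Real.pi) / ε by positivity)
    calc _ = 1 / (n : ℝ) * (∫ u, charFunMajorant k M ε u) +
          √(2 * Real.pi) / ε * ((n : ℝ) ^ 2 * Real.exp (-(2 * κ * n))) := by ring
      _ ≤ _ := by gcongr
  have hvh : (v : ℝ) / (1 / n) ^ 2 ≤ 1 / n := by
    rw [hvr, one_div, inv_pow, div_inv_eq_mul]
    have : ((n : ℝ) ^ 4)⁻¹ * (n : ℝ) ^ 2 = ((n : ℝ) ^ 2)⁻¹ := by field_simp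
    rw [this]
    exact inv_anti₀ hn0 (le_self_pow₀ hn1' (by norm_num))
  refine hfinal.trans ?_
  calc _ ≤ (1 / n * (∫ u, charFunMajorant k M ε u) + √(2 * Real.pi) / ε * (1 / n)) + 1 / n +
        11 * (1 / n) := by gcongr
    _ = _ := by ring

/-! ### The intensity measure and the law of the standardized empirical mean. -/

section Model

variable {T : Set ℝ} {l : ℝ → ℝ}

instance (T : Set ℝ) (l : ℝ → ℝ) : SigmaFinite (intensityMeasure T l) :=
  inferInstanceAs (SigmaFinite ((volume.restrict T).withDensity fun t => ENNReal.ofReal (l t)))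

lemma intensityMeasure_compl (hT : MeasurableSet T) : intensityMeasure T l Tᶜ = 0 := by
  rw [intensityMeasure, withDensity_apply _ hT.compl, Measure.restrict_restrict hT.compl]
  simp

lemma ae_mem_intensityMeasure (hT : MeasurableSet T) : ∀ᵐ t ∂(intensityMeasure T l), t ∈ T :=
  intensityMeasure_compl hT

lemma integral_intensityMeasure (hT : MeasurableSet T) (hl : Measurable l)
    (hl0 : ∀ t ∈ T, 0 ≤ l t) (F : ℝ → ℝ) :
    ∫ t, F t ∂(intensityMeasure T l) = ∫ t in T, F t * l t := by
  rw [intensityMeasure, integral_withDensity_eq_integral_toReal_smul hl.ennreal_ofReal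
    (ae_of_all _ fun _ => ENNReal.ofReal_lt_top)]
  refine setIntegral_congr_fun hT fun t ht => ?_
  simp [ENNReal.toReal_ofReal (hl0 t ht), mul_comm]

lemma integrable_pow_intensityMeasure (hl : Measurable l) {g : ℝ → ℝ} (hg : Measurable g) {r : ℕ}
    (h : ∫⁻ t in T, ENNReal.ofReal (|g t| ^ (r : ℝ) * l t) < ∞) :
    Integrable (fun t => g t ^ r) (intensityMeasure T l) := by
  refine ⟨(hg.pow_const r).aestronglyMeasurable, ?_⟩
  rw [HasFiniteIntegral, intensityMeasure,
    lintegral_withDensity_eq_lintegral_mul _ hl.ennreal_ofReal (hg.pow_const r).enorm]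
  refine lt_of_le_of_lt (lintegral_mono fun t => le_of_eq ?_) h
  simp only [Pi.mul_apply]
  rw [Real.enorm_eq_ofReal_abs, mul_comm, ← ENNReal.ofReal_mul (abs_nonneg _), abs_pow,
    Real.rpow_natCast]

end Model

/-- The characteristic function of the centred and normalized sum of the integrals of `h` with
respect to independent Poisson processes. -/
theorem charFun_normalized_sum {Ω : Type*} [MeasurableSpace Ω] {P : Measure Ω}
    [IsProbabilityMeasure P] {μ : Measure ℝ} [SigmaFinite μ] {X : ℕ → Ω → Measure ℝ}
    (hX : ∀ j, IsPoissonProcess P (X j) μ) (hindep : iIndepFun X P) {h : ℝ → ℝ}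
    (hh : Measurable h) (hi : Integrable h μ) (n : ℕ) (t u : ℝ) :
    charFun (P.map fun ω => t * (∑ j ∈ Finset.range n, ∫ x, h x ∂(X j ω)) -
      t * (n * ∫ x, h x ∂μ)) u = Complex.exp (n * cumulant μ h (u * t)) := by
  have hm : ∀ j, Measurable fun ω => ∫ x, h x ∂(X j ω) := fun j =>
    (measurable_integral_measure hh).comp (hX j).measurable
  have hind : iIndepFun (fun j ω => ∫ x, h x ∂(X j ω)) P :=
    hindep.comp (fun _ M => ∫ x, h x ∂M) fun _ => measurable_integral_measure hh
  have hS : Measurable fun ω => ∑ j ∈ Finset.range n, ∫ x, h x ∂(X j ω) :=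
    Finset.measurable_sum _ fun j _ => hm j
  have h1 : P.map (fun ω => t * (∑ j ∈ Finset.range n, ∫ x, h x ∂(X j ω)) -
      t * (n * ∫ x, h x ∂μ)) = (P.map fun ω => t * (∑ j ∈ Finset.range n, ∫ x, h x ∂(X j ω))).map
        (· + (-(t * (n * ∫ x, h x ∂μ)))) := by
    rw [Measure.map_map (by fun_prop) (hS.const_mul t)]
    rfl
  rw [h1, charFun_map_add_const, charFun_map_mul_comp hS.aemeasurable,
    (hind.restrict _).charFun_map_fun_finsetSum_eq_prod (fun j _ => (hm j).aemeasurable),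
    Finset.prod_apply]
  simp only [fun j => (hX j).charFun_integral hh hi (t * u)]
  rw [Finset.prod_const, Finset.card_range, ← Complex.exp_nat_mul, ← Complex.exp_add,
    cumulant_eq hh hi, mul_comm u t]
  congr 1
  simp only [Real.inner_apply]
  push_cast
  ring

/-! ### The inverse of the mean function and the estimator. -/

section Inverse

variable {m : ℝ → ℝ} {α β : ℝ}

lemma deriv_nonneg_of_monotoneOn_Ioo (h : MonotoneOn m (Set.Ioo α β)) {θ : ℝ}
    (hθ : θ ∈ Set.Ioo α β) : 0 ≤ deriv m θ := by
  rw [← derivWithin_of_isOpen isOpen_Ioo hθ]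
  exact h.derivWithin_nonneg

lemma deriv_nonpos_of_antitoneOn_Ioo (h : AntitoneOn m (Set.Ioo α β)) {θ : ℝ}
    (hθ : θ ∈ Set.Ioo α β) : deriv m θ ≤ 0 := by
  rw [← derivWithin_of_isOpen isOpen_Ioo hθ]
  exact h.derivWithin_nonpos

lemma strictMonoOn_Icc_of_deriv_ne_zero (hcont : ContinuousOn m (Set.Icc α β))
    (h : MonotoneOn m (Set.Ioo α β)) (hd : ∀ θ ∈ Set.Ioo α β, deriv m θ ≠ 0) :
    StrictMonoOn m (Set.Icc α β) := by
  refine strictMonoOn_of_deriv_pos (convex_Icc α β) hcont fun θ hθ => ?_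
  rw [interior_Icc] at hθ
  exact (deriv_nonneg_of_monotoneOn_Ioo h hθ).lt_of_ne' (hd θ hθ)

lemma strictAntiOn_Icc_of_deriv_ne_zero (hcont : ContinuousOn m (Set.Icc α β))
    (h : AntitoneOn m (Set.Ioo α β)) (hd : ∀ θ ∈ Set.Ioo α β, deriv m θ ≠ 0) :
    StrictAntiOn m (Set.Icc α β) := by
  refine strictAntiOn_of_deriv_neg (convex_Icc α β) hcont fun θ hθ => ?_
  rw [interior_Icc] at hθ
  exact (deriv_nonpos_of_antitoneOn_Ioo h hθ).lt_of_ne (hd θ hθ)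

lemma hasStrictDerivAt_invFunOn (hinj : Set.InjOn m (Set.Icc α β))
    (hm : ContDiffOn ℝ 2 m (Set.Ioo α β)) (hd : ∀ θ ∈ Set.Ioo α β, deriv m θ ≠ 0) {θ : ℝ}
    (hθ : θ ∈ Set.Ioo α β) :
    HasStrictDerivAt (Function.invFunOn m (Set.Icc α β)) (deriv m θ)⁻¹ (m θ) := by
  have hnhds : Set.Ioo α β ∈ 𝓝 θ := isOpen_Ioo.mem_nhds hθ
  have hs : HasStrictDerivAt m (deriv m θ) θ :=
    (hm.contDiffAt hnhds).hasStrictDerivAt (by norm_num)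
  refine hs.to_local_left_inverse (hd θ hθ) ?_
  filter_upwards [hnhds] with x hx
  exact hinj.leftInvOn_invFunOn (Set.Ioo_subset_Icc_self hx)

lemma hasDerivAt_deriv_of_contDiffOn (hm : ContDiffOn ℝ 2 m (Set.Ioo α β)) {θ : ℝ}
    (hθ : θ ∈ Set.Ioo α β) : HasDerivAt (deriv m) (deriv (deriv m) θ) θ := by
  have h := (contDiffOn_succ_iff_deriv_of_isOpen (n := 1) isOpen_Ioo).1
    (by norm_num; exact hm)
  exact ((h.2.2.contDiffAt (isOpen_Ioo.mem_nhds hθ)).differentiableAt (by norm_num)).hasDerivAt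

/-- Near `m θ` the derivative of the inverse is `1 / m' ∘ G`, which is differentiated once more by
the chain rule. -/
lemma hasDerivAt_deriv_invFunOn (hinj : Set.InjOn m (Set.Icc α β))
    (hm : ContDiffOn ℝ 2 m (Set.Ioo α β)) (hd : ∀ θ ∈ Set.Ioo α β, deriv m θ ≠ 0) {θ : ℝ}
    (hθ : θ ∈ Set.Ioo α β) :
    HasDerivAt (deriv (Function.invFunOn m (Set.Icc α β)))
      (-deriv (deriv m) θ / deriv m θ ^ 3) (m θ) := by
  set G := Function.invFunOn m (Set.Icc α β) with hG
  have hnhds : Set.Ioo α β ∈ 𝓝 θ := isOpen_Ioo.mem_nhds hθ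
  have hs : HasStrictDerivAt m (deriv m θ) θ :=
    (hm.contDiffAt hnhds).hasStrictDerivAt (by norm_num)
  have hGm : ∀ x ∈ Set.Ioo α β, G (m x) = x := fun x hx =>
    hinj.leftInvOn_invFunOn (Set.Ioo_subset_Icc_self hx)
  have hev : deriv G =ᶠ[𝓝 (m θ)] fun y => (deriv m (G y))⁻¹ := by
    -- A nonzero strict derivative makes `m` carry neighbourhoods of `θ` onto those of `m θ`, so the
    -- identity need only be checked at points `m x`.
    rw [← hs.map_nhds_eq (hd θ hθ)]
    refine Filter.eventually_map.2 ?_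
    filter_upwards [hnhds] with x hx
    rw [hGm x hx]
    exact (hasStrictDerivAt_invFunOn hinj hm hd hx).hasDerivAt.deriv
  have hG1 := (hasStrictDerivAt_invFunOn hinj hm hd hθ).hasDerivAt
  have h2 : HasDerivAt (deriv m) (deriv (deriv m) θ) (G (m θ)) := by
    rw [hGm θ hθ]; exact hasDerivAt_deriv_of_contDiffOn hm hθ
  have h3 := (h2.comp (m θ) hG1).inv (by simpa [hGm θ hθ] using hd θ hθ)
  refine (h3.congr_of_eventuallyEq hev).congr_deriv ?_
  have := hd θ hθ
  simp only [Function.comp_apply, hGm θ hθ]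
  field_simp

/-- If `x < z` but `y ≥ m z`, then `z` fits strictly better than `x`. If `y < m z ≤ m x`, a point
slightly to the left of `z` fits strictly better; `z` itself would not exclude `x = z`. -/
lemma IsMME.lt_iff {y x z : ℝ} (hcont : ContinuousOn m (Set.Icc α β))
    (hmono : StrictMonoOn m (Set.Icc α β)) (hx : IsMME α β m y x) (hz : z ∈ Set.Ioo α β) :
    x < z ↔ y < m z := by
  have hzI := Set.Ioo_subset_Icc_self hz
  constructor
  · intro hxz
    by_contra hcon
    push Not at hcon
    have h1 := hmono hx.1 hzI hxz
    have h2 := hx.2 z hz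
    nlinarith
  · intro hy
    by_contra hcon
    push Not at hcon
    have h1 : m z ≤ m x := hmono.monotoneOn hzI hx.1 hcon
    have hca : ContinuousAt m z := hcont.continuousAt (Icc_mem_nhds hz.1 hz.2)
    have hev : ∀ᶠ θ in 𝓝[<] z, y < m θ ∧ θ ∈ Set.Ioo α z := by
      refine ((hca.eventually (lt_mem_nhds hy)).filter_mono nhdsWithin_le_nhds).and ?_
      exact Ioo_mem_nhdsLT hz.1
    obtain ⟨θ, hθy, hθ⟩ := hev.exists
    have hθI : θ ∈ Set.Ioo α β := ⟨hθ.1, hθ.2.trans hz.2⟩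
    have h2 := hmono (Set.Ioo_subset_Icc_self hθI) hzI hθ.2
    have h3 := hx.2 θ hθI
    nlinarith

lemma exists_taylor_two_le (hm : ContDiffOn ℝ 2 m (Set.Ioo α β)) {θ : ℝ}
    (hθ : θ ∈ Set.Ioo α β) {δ : ℝ} (hδ : 0 < δ) :
    ∃ ρ > 0, ∀ h, |h| < ρ → θ + h ∈ Set.Ioo α β ∧
      |m (θ + h) - m θ - deriv m θ * h - deriv (deriv m) θ / 2 * h ^ 2| ≤ δ * h ^ 2 := by
  have h := taylor_isLittleO (n := 2) (convex_Ioo α β) hθ (by exact_mod_cast hm)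
  have h2 := h.bound hδ
  rw [isOpen_Ioo.nhdsWithin_eq hθ] at h2
  obtain ⟨ρ, hρ, hb⟩ := Metric.eventually_nhds_iff.1 (h2.and (isOpen_Ioo.mem_nhds hθ))
  refine ⟨ρ, hρ, fun t ht => ?_⟩
  obtain ⟨h3, h4⟩ := hb (y := θ + t) (by simpa [Real.dist_eq] using ht)
  refine ⟨h4, ?_⟩
  rw [taylorWithinEval_succ, taylorWithinEval_succ, taylor_within_zero_eval,
    iteratedDerivWithin_of_isOpen isOpen_Ioo hθ, iteratedDerivWithin_of_isOpen isOpen_Ioo hθ,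
    iteratedDeriv_succ, iteratedDeriv_succ, iteratedDeriv_zero] at h3
  simp only [add_sub_cancel_left, Real.norm_eq_abs, abs_pow, sq_abs] at h3
  refine le_trans (le_of_eq ?_) h3
  congr 1
  simp [iteratedDeriv_one]
  ring

end Inverse

/-! ### The Edgeworth approximation at a perturbed argument. -/

/-- Mean value inequality: between `y` and `x`, `edgePDF c` differs from `f(y)` by at most `10 |c| +
|x - y|`, as `f` is 1-Lipschitz. With `c` and `x - y` of order `n^{-1/2}` the error is `O(1/n)`. -/
lemma abs_edgeCDF_sub_sub_le (c x y : ℝ) :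
    |edgeCDF c x - edgeCDF c y - (x - y) * gaussianPDFReal 0 1 y| ≤
      |x - y| * (10 * |c| + |x - y|) := by
  have hf : ∀ t, |gaussianPDFReal 0 1 t - gaussianPDFReal 0 1 y| ≤ |t - y| := fun t => by
    have := Convex.norm_image_sub_le_of_norm_hasDerivWithin_le (s := Set.univ) (x := y) (y := t)
      (C := 1) (fun t _ => (hasDerivAt_gaussianPDFReal_std t).hasDerivWithinAt)
      (fun t _ => ?_) convex_univ trivial trivial
    · simpa using this
    · have h0 := gaussianPDFReal_nonneg 0 1 t
      have h1 := gaussianPDFReal_std_le t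
      rw [norm_mul, norm_neg, Real.norm_eq_abs, Real.norm_of_nonneg h0, mul_comm]
      refine le_trans ?_ h1
      gcongr
      nlinarith [sq_nonneg (|t| - 1), sq_abs t, sq_nonneg (t ^ 2)]
  have hseg : ∀ t ∈ Set.uIcc y x, |t - y| ≤ |x - y| := fun t ht =>
    Set.abs_sub_left_of_mem_uIcc ht
  have h := Convex.norm_image_sub_le_of_norm_hasDerivWithin_le (s := Set.uIcc y x) (x := y)
    (y := x) (C := 10 * |c| + |x - y|) (f := fun t => edgeCDF c t - t * gaussianPDFReal 0 1 y)
    (fun t _ => ((hasDerivAt_edgeCDF c t).sub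
      ((hasDerivAt_id t).mul_const (gaussianPDFReal 0 1 y))).hasDerivWithinAt)
    (fun t ht => ?_) (convex_uIcc y x) Set.left_mem_uIcc Set.right_mem_uIcc
  · simp only [Real.norm_eq_abs] at h
    rw [mul_comm (10 * |c| + |x - y|)] at h
    refine le_trans (le_of_eq ?_) h
    congr 1
    ring
  · have h1 : edgePDF c t - 1 * gaussianPDFReal 0 1 y =
        c * (gaussianPDFReal 0 1 t * (t ^ 3 - 3 * t)) +
          (gaussianPDFReal 0 1 t - gaussianPDFReal 0 1 y) := by
      rw [edgePDF]; ring
    rw [h1, Real.norm_eq_abs]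
    refine (abs_add_le _ _).trans (add_le_add ?_ ((hf t).trans (hseg t ht)))
    rw [abs_mul, mul_comm]
    gcongr
    exact abs_gaussianPDFReal_mul_cubic_le t

lemma rpow_three_halves (a : ℝ) (ha : 0 ≤ a) : a ^ (3 / 2 : ℝ) = √a ^ 3 := by
  rw [Real.sqrt_eq_rpow, ← Real.rpow_natCast, ← Real.rpow_mul ha]
  norm_num

/-- Splits the target into the expansion of the empirical mean and the first-order effect of moving
its argument by `-b₂ y² / √n`. -/
lemma edgeworth_eq {a₂ : ℝ} (ha₂ : 0 < a₂) (a₃ b₂ : ℝ) (n : ℕ) (y : ℝ) :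
    edgeworth a₂ a₃ b₂ n y = edgeCDF (a₃ / (6 * √a₂ ^ 3) / √n) y -
      b₂ * y ^ 2 / √n * gaussianPDFReal 0 1 y := by
  have hq : 0 < √a₂ := Real.sqrt_pos.2 ha₂
  rw [edgeworth, edgeCDF, rpow_three_halves a₂ ha₂.le]
  field_simp
  ring

/-- The first order Edgeworth expansion along a perturbed argument. -/
lemma abs_edgeCDF_sub_edgeworth_le {a₂ : ℝ} (ha₂ : 0 < a₂) {a₃ b₂ : ℝ} {n : ℕ} (hn : 0 < n)
    {x y B η : ℝ} (hy : |y| ≤ B) (hη : 0 ≤ η)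
    (hx : |x - y + b₂ * y ^ 2 / √n| ≤ η / √n) :
    |edgeCDF (a₃ / (6 * √a₂ ^ 3) / √n) x - edgeworth a₂ a₃ b₂ n y| ≤
      (|b₂| * B ^ 2 + η) * (10 * |a₃ / (6 * √a₂ ^ 3)| + (|b₂| * B ^ 2 + η)) / n + η / √n := by
  set c := a₃ / (6 * √a₂ ^ 3)
  set A := |b₂| * B ^ 2 + η with hA
  have hn' : (0 : ℝ) < n := by exact_mod_cast hn
  have hs : 0 < √(n : ℝ) := Real.sqrt_pos.2 hn'
  have hs2 : √(n : ℝ) * √(n : ℝ) = n := Real.mul_self_sqrt hn'.le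
  have hB : 0 ≤ B := (abs_nonneg y).trans hy
  have hA0 : 0 ≤ A := by positivity
  have hw : |x - y| ≤ A / √n := by
    have e : x - y = (x - y + b₂ * y ^ 2 / √n) - b₂ * y ^ 2 / √n := by ring
    have h1 : |b₂ * y ^ 2 / √n| ≤ |b₂| * B ^ 2 / √n := by
      rw [abs_div, abs_mul, abs_of_pos hs, abs_pow]
      gcongr
    rw [e]
    refine (abs_sub _ _).trans ((add_le_add hx h1).trans (le_of_eq ?_))
    rw [hA]; ring
  have h1 := abs_edgeCDF_sub_sub_le (c / √n) x y
  rw [edgeworth_eq ha₂]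
  have e : edgeCDF (c / √n) x - (edgeCDF (c / √n) y - b₂ * y ^ 2 / √n * gaussianPDFReal 0 1 y) =
      (edgeCDF (c / √n) x - edgeCDF (c / √n) y - (x - y) * gaussianPDFReal 0 1 y) +
        (x - y + b₂ * y ^ 2 / √n) * gaussianPDFReal 0 1 y := by ring
  rw [e]
  refine (abs_add_le _ _).trans (add_le_add (h1.trans ?_) ?_)
  · rw [abs_div, abs_of_pos hs]
    calc _ ≤ A / √n * (10 * (|c| / √n) + A / √n) := by gcongr
      _ = A * (10 * |c| + A) / (√n * √n) := by field_simp
      _ = _ := by rw [hs2]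
  · rw [abs_mul, abs_of_nonneg (gaussianPDFReal_nonneg 0 1 y)]
    calc _ ≤ η / √n * 1 := mul_le_mul hx (gaussianPDFReal_std_le_one y)
          (gaussianPDFReal_nonneg 0 1 y) (by positivity)
      _ = _ := mul_one _

end PoissonMME

/-! ### Assembly: from the empirical mean to the estimator. -/

theorem proposition1
    {Ω : Type*} [MeasurableSpace Ω] (P : Measure Ω) [IsProbabilityMeasure P]
    -- the model: an interval `T`, the parameter set `Θ = (α, β)`, intensities and weight function
    (T : Set ℝ) (hT : T.OrdConnected) (α β : ℝ)
    (lam : ℝ → ℝ → ℝ) (g : ℝ → ℝ) (hg : Measurable g)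
    (hlam_meas : ∀ θ ∈ Set.Icc α β, Measurable (lam θ))
    (hlam_nonneg : ∀ θ ∈ Set.Icc α β, ∀ t ∈ T, 0 ≤ lam θ t)
    (hint : ∀ θ ∈ Set.Icc α β, IntegrableOn (fun t => g t * lam θ t) T)
    (hcont : ContinuousOn (meanFun T g lam) (Set.Icc α β))
    -- the regularity conditions
    (k : ℕ) (hk : 1 ≤ k) (hreg : Regularity α β T g lam k)
    -- independent Poisson processes with the true parameter `θ₀`
    (θ₀ : ℝ) (hθ₀ : θ₀ ∈ Set.Ioo α β)
    (X : ℕ → Ω → Measure ℝ)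
    (hX : ∀ j, IsPoissonProcess P (X j) (intensityMeasure T (lam θ₀)))
    (hindep : iIndepFun X P)
    -- the method of moments estimators
    (est : ℕ → Ω → ℝ)
    (hest : ∀ n : ℕ, ∀ᵐ ω ∂P, IsMME α β (meanFun T g lam) (empMean T g X n ω) (est n ω))
    -- the remaining conditions
    (hψ : 0 < psi α β T g lam θ₀ 1)
    (ha₂ : 0 < aCoef T g lam θ₀ 2)
    (b : ℝ) (hb : 0 < b)
    (hcramer : 0 < ⨅ v : {v : ℝ // 1 < aCoef T g lam θ₀ 2 * b * |v|},
      ∫ t in T, Real.sin ((v : ℝ) * g t) ^ 2 * lam θ₀ t) :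
    ∀ K : Set ℝ, IsCompact K → ∀ δ : ℝ, 0 < δ → ∀ᶠ n : ℕ in atTop, ∀ y ∈ K,
      |P.real {ω | √(n : ℝ) * (est n ω - θ₀) /
            (psi α β T g lam θ₀ 1 * √(aCoef T g lam θ₀ 2)) < y} -
          edgeworth (aCoef T g lam θ₀ 2) (aCoef T g lam θ₀ 3) (b2Coef α β T g lam θ₀) n y|
        ≤ δ * (1 / √(n : ℝ)) := by
  intro K hK δ hδ
  have hTm : MeasurableSet T := hT.measurableSet
  have hθI := Set.Ioo_subset_Icc_self hθ₀
  set l := lam θ₀ with hl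
  have hlm : Measurable l := hlam_meas θ₀ hθI
  have hl0 : ∀ t ∈ T, 0 ≤ l t := hlam_nonneg θ₀ hθI
  set μ := intensityMeasure T l with hμ
  set m := meanFun T g lam with hm
  -- the weight function, extended by zero outside `T`
  set h := T.indicator g with hh
  have hhm : Measurable h := hg.indicator hTm
  have hhg : h =ᵐ[μ] g := by
    filter_upwards [ae_mem_intensityMeasure hTm] with t ht using Set.indicator_of_mem ht g
  have hpow : ∀ r : ℕ, (fun t => h t ^ r) =ᵐ[μ] fun t => g t ^ r := fun r => by
    filter_upwards [hhg] with t ht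
    rw [ht]
  have hmom : ∀ r : ℕ, 0 < r → Integrable (fun t => h t ^ r) μ := by
    intro r hr
    refine (integrable_pow_intensityMeasure hlm hg (lt_of_le_of_lt ?_
      (hreg.moments r (by exact_mod_cast hr)))).congr (hpow r).symm
    exact le_iSup₂ (f := fun θ _ => ∫⁻ t in T, ENNReal.ofReal (|g t| ^ (r : ℝ) * lam θ t)) θ₀ hθ₀
  have hcoef : ∀ r : ℕ, ∫ t, h t ^ r ∂μ = aCoef T g lam θ₀ r := fun r => by
    rw [integral_congr_ae (hpow r), integral_intensityMeasure hTm hlm hl0]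
    rfl
  have h1 : Integrable h μ := by simpa using hmom 1 one_pos
  have hmean : ∫ t, h t ∂μ = m θ₀ := by
    rw [integral_congr_ae hhg, integral_intensityMeasure hTm hlm hl0]
    rfl
  set a₂ := aCoef T g lam θ₀ 2 with ha₂_def
  set a₃ := aCoef T g lam θ₀ 3
  set b₂ := b2Coef α β T g lam θ₀ with hb₂
  set ψ₁ := psi α β T g lam θ₀ 1 with hψ₁
  have hq : 0 < √a₂ := Real.sqrt_pos.2 ha₂
  -- Edgeworth expansion of the law of the empirical mean
  obtain ⟨C, hC⟩ := exists_abs_measureReal_Iio_sub_edgeCDF_le hhm h1 (hmom 2 two_pos)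
    (hmom 3 three_pos) (hmom 4 four_pos) hq ((hcoef 2).trans (Real.sq_sqrt ha₂.le).symm) hcramer
    (V := 1 / (a₂ * b)) (fun v hv => by
      have hv' : 1 < a₂ * b * |v| := by
        rw [div_lt_iff₀ (by positivity)] at hv
        linarith
      refine (ciInf_le ⟨0, ?_⟩ (⟨v, hv'⟩ : {v : ℝ // 1 < a₂ * b * |v|})).trans (le_of_eq ?_)
      · rintro _ ⟨v, rfl⟩
        exact setIntegral_nonneg hTm fun t ht => mul_nonneg (sq_nonneg _) (hl0 t ht)
      · rw [← integral_intensityMeasure hTm hlm hl0 fun t => Real.sin (v * g t) ^ 2]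
        refine integral_congr_ae ?_
        filter_upwards [hhg] with t ht
        rw [ht])
  rw [hcoef 3] at hC
  -- the inverse of the mean function
  have hm2 : ContDiffOn ℝ 2 m (Set.Ioo α β) :=
    hreg.smooth.of_le (by exact_mod_cast (by omega : 2 ≤ k + 2))
  have hd : ∀ θ ∈ Set.Ioo α β, deriv m θ ≠ 0 := by
    obtain ⟨κ, hκ, hκ'⟩ := hreg.deriv_lower
    intro θ hθ h0
    have := hκ' θ hθ
    rw [← hm, h0, abs_zero] at this
    linarith
  have hinj : Set.InjOn m (Set.Icc α β) := hreg.monotone.elim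
    (fun hmo => (strictMonoOn_Icc_of_deriv_ne_zero hcont hmo hd).injOn)
    (fun hmo => (strictAntiOn_Icc_of_deriv_ne_zero hcont hmo hd).injOn)
  have hψ₁' : ψ₁ = (deriv m θ₀)⁻¹ := by
    rw [hψ₁, psi, iteratedDeriv_one, invMean,
      (hasStrictDerivAt_invFunOn hinj hm2 hd hθ₀).hasDerivAt.deriv]
    simp
  -- The sign of `ψ₁` excludes the decreasing case.
  have hd0 : 0 < deriv m θ₀ := inv_pos.1 (hψ₁' ▸ hψ)
  have hmono : StrictMonoOn m (Set.Icc α β) := by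
    refine strictMonoOn_Icc_of_deriv_ne_zero hcont (hreg.monotone.resolve_right fun hanti => ?_) hd
    exact absurd (deriv_nonpos_of_antitoneOn_Ioo hanti hθ₀) (not_le.2 hd0)
  have hb₂' : b₂ = -(deriv (deriv m) θ₀ / 2 * ψ₁ ^ 2 * √a₂) := by
    have : psi α β T g lam θ₀ 2 = -deriv (deriv m) θ₀ / deriv m θ₀ ^ 3 / 2 := by
      rw [psi, iteratedDeriv_succ, iteratedDeriv_one, invMean,
        (hasDerivAt_deriv_invFunOn hinj hm2 hd hθ₀).deriv]
      norm_num
    rw [hb₂, b2Coef, this, ← hψ₁, ← ha₂_def, hψ₁']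
    field_simp
  -- constants
  obtain ⟨B, hB⟩ := hK.isBounded.exists_norm_le
  -- The maximum with `1` makes the bound positive, since it is divided by below.
  set B' := max B 1
  have hB' : ∀ y ∈ K, |y| ≤ B' := fun y hy => (hB y hy).trans (le_max_left _ _)
  have hB0 : 0 < B' := lt_of_lt_of_le one_pos (le_max_right _ _)
  set d := ψ₁ * √a₂ with hd_def
  have hd_pos : 0 < d := mul_pos hψ hq
  set η := δ / 2 with hη
  have hη0 : 0 < η := half_pos hδ
  -- The tolerance is such that, at increment `y d / s` with `|y| ≤ B'` and after multiplication by
  -- `s / √a₂`, the Taylor remainder is at most `η / s`.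
  obtain ⟨ρ, hρ, htay⟩ := exists_taylor_two_le hm2 hθ₀
    (show 0 < η * √a₂ / (B' * d) ^ 2 by positivity)
  set A := |b₂| * B' ^ 2 + η
  set E := C + A * (10 * |a₃ / (6 * √a₂ ^ 3)| + A)
  have hsq : Tendsto (fun n : ℕ => √(n : ℝ)) atTop atTop :=
    Real.tendsto_sqrt_atTop.comp tendsto_natCast_atTop_atTop
  filter_upwards [hC, eventually_gt_atTop 0, hsq.eventually_gt_atTop (B' * d / ρ),
    hsq.eventually_ge_atTop (E / η)] with n hCn hn0 hnρ hnE y hy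
  have hn' : (0 : ℝ) < n := by exact_mod_cast hn0
  set s := √(n : ℝ) with hs
  have hs0 : 0 < s := Real.sqrt_pos.2 hn'
  have hs2 : s ^ 2 = n := Real.sq_sqrt hn'.le
  have hyB := hB' y hy
  -- the normalized empirical mean
  set t := 1 / (s * √a₂) with ht
  set W : Ω → ℝ := fun ω => t * (∑ j ∈ Finset.range n, ∫ x, h x ∂(X j ω)) - t * (n * ∫ x, h x ∂μ)
    with hW
  have hWm : Measurable W :=
    ((Finset.measurable_sum _ fun j _ => (measurable_integral_measure hhm).comp
      (hX j).measurable).const_mul _).sub_const _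
  have hprob : IsProbabilityMeasure (P.map W) := Measure.isProbabilityMeasure_map hWm.aemeasurable
  have hemp : ∀ ω, W ω = s * (empMean T g X n ω - m θ₀) / √a₂ := by
    intro ω
    simp only [hW]
    rw [hmean]
    simp only [empMean, hh, integral_indicator hTm, ht, ← hs2]
    field_simp
  have hz : |y * d / s| < ρ := by
    rw [abs_div, abs_mul, abs_of_pos hs0, abs_of_pos hd_pos, div_lt_iff₀ hs0]
    rw [div_lt_iff₀ hρ] at hnρ
    calc |y| * d ≤ B' * d := by gcongr
      _ < _ := by linarith
  obtain ⟨hzI, hzt⟩ := htay _ hz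
  set z := θ₀ + y * d / s with hzdef
  set x := s * (m z - m θ₀) / √a₂ with hx
  have hset : P.real {ω | s * (est n ω - θ₀) / d < y} = (P.map W).real (Set.Iio x) := by
    rw [map_measureReal_apply hWm measurableSet_Iio]
    -- The two events agree outside the null set where `est n` may fail to be a minimiser;
    -- measurability of `est n` plays no role.
    refine measureReal_congr ?_
    filter_upwards [hest n] with ω hω
    refine propext ?_
    have e1 : s * (est n ω - θ₀) / d < y ↔ est n ω < z := by
      rw [div_lt_iff₀ hd_pos, hzdef, ← sub_lt_iff_lt_add', lt_div_iff₀ hs0, mul_comm s]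
    have e2 : W ω < x ↔ empMean T g X n ω < m z := by
      rw [hemp, hx, div_lt_div_iff_of_pos_right hq, mul_lt_mul_iff_right₀ hs0, sub_lt_sub_iff_right]
    exact e1.trans ((hω.lt_iff hcont hmono hzI).trans e2.symm)
  have hxy : |x - y + b₂ * y ^ 2 / s| ≤ η / s := by
    -- The linear Taylor term is `y` because `m'(θ₀) ψ₁ = 1`, and the quadratic one is `-b₂ y² / s`
    -- by the formula for `b₂`; only the remainder is left.
    have e : x - y + b₂ * y ^ 2 / s = s / √a₂ * (m z - m θ₀ - deriv m θ₀ * (y * d / s) -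
        deriv (deriv m) θ₀ / 2 * (y * d / s) ^ 2) := by
      have hmψ : deriv m θ₀ * ψ₁ = 1 := by rw [hψ₁']; exact mul_inv_cancel₀ hd0.ne'
      have e1 : s / √a₂ * (deriv m θ₀ * (y * d / s)) = y := by
        rw [hd_def]
        field_simp
        linear_combination y * hmψ
      have e2 : s / √a₂ * (deriv (deriv m) θ₀ / 2 * (y * d / s) ^ 2) = -(b₂ * y ^ 2 / s) := by
        rw [hd_def, hb₂']
        field_simp
      rw [mul_sub, mul_sub, e1, e2, hx]
      ring
    rw [e, abs_mul, abs_of_pos (by positivity)]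
    calc _ ≤ s / √a₂ * (η * √a₂ / (B' * d) ^ 2 * (y * d / s) ^ 2) := by gcongr
      _ = η / s * (|y| / B') ^ 2 := by
        rw [div_pow |y| B', sq_abs]
        field_simp
      _ ≤ η / s * 1 := by
        gcongr
        exact pow_le_one₀ (by positivity) ((div_le_one hB0).2 hyB)
      _ = _ := mul_one _
  have hmain := hCn (P.map W) (fun u => by
    rw [hW, charFun_normalized_sum hX hindep hhm h1 n t u, ht]
    ring_nf) x
  have hedge := abs_edgeCDF_sub_edgeworth_le ha₂ (a₃ := a₃) hn0 hyB hη0.le hxy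
  have hE : E / n ≤ η / s := by
    rw [div_le_iff₀ hη0] at hnE
    rw [← hs2, div_le_div_iff₀ (by positivity) hs0]
    nlinarith
  rw [hset]
  calc _ ≤ C / n + (A * (10 * |a₃ / (6 * √a₂ ^ 3)| + A) / n + η / s) :=
        (abs_sub_le _ _ _).trans (add_le_add hmain hedge)
    _ = E / n + η / s := by ring
    _ ≤ η / s + η / s := by gcongr
    _ = _ := by rw [hη]; ring
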